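/- **Setting.** A rule has a disjunction of atoms as head and a body that is a finite set of positive literals, negative literals, arithmetic expressions $X=\varphi(\mathbf Y)$ (built with $+,-,*,/$ over the integers) and aggregate expressions $t\preccurlyeq\#agg\{\mathbf t:\phi\}$ with $agg\in\{sum,count,max,min\}$, which may be nested. A program $P$ is a finite set of such rules together with finitely many weak constraints $\bot\leftarrow B\,[k:\mathbf t]$. The *global* variables of a rule are those that occur outside the braces of aggregates. An interpretation is a set of ground atoms; rules are instantiated over all constants (the integers and the symbolic constants). The reduct of $P$ with respect to $I$ keeps the instances whose negative literals, arithmetic expressions and aggregates are true in $I$ and deletes their negative literals; $I$ is an answer set if it is a model of $P$, over the predicates of $P$, and no proper subset of $I$ is a model of the reduct. The weight $w_P(I)$ is the sum of $k$ over the set of all instances $(k,\mathbf c)$ of annotations $[k:\mathbf t]$ of weak constraints whose body is true in $I$ (undefined if this is an infinite sum); an answer set is optimal if its weight is defined and minimal. A variable is *safe* with respect to a set of body elements if it occurs in a positive atom, or is the left-hand side of an arithmetic expression all of whose right-hand side variables are safe; $P$ is safe if all global variables of each rule and weak constraint are safe and, inside each aggregate, all variables are safe given those that come from outside. *Aggregates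 are non-recursive* in $P$ if predicates have levels such that each head predicate of a rule is at least as high as those of its positive body and strictly higher than all those inside its aggregates. **Algorithm.** $P$ is rewritten by finitely many steps of the following kinds, in any order, also applied to rules generated before; "fresh" means not occurring in the current program, and all fresh predicates of a step are different. 1. *Rule.* For a rule $\pi$ take a tree decomposition $(T,\chi)$ of its rule graph (vertices: the global variables; edges: between global variables that occur together in the head or in one body element, aggregates included) such that the root bag contains all head variables. For every node $n\neq root$ with parent $p_n$, let $\mathbf Y_n=\chi(n)\cap\chi(p_n)$ and let $temp_n$ be fresh. Replace $\pi$ by one rule for each node $n$: its head is $temp_n(\mathbf Y_n)$ (for the root: the head of $\pi$); its body consists of the body elements of $\pi$ whose global variables all lie in $\chi(n)$, the atoms $temp_m(\mathbf Y_m)$ for the children $m$ of $n$, and atoms $dom_X(X)$, $dom_X$ fresh, for each $X$ that occurs in one of these negative literals but in none of these positive body literals of $\pi$, and for each variable of the rule that would otherwise be unsafe. For each such $X$ add the rule $dom_X(X)\leftarrow A_X$, where $A_X$ is selected greedily from the body of $\pi$: starting with $\mathbf S=\{X\}$, remove a variable $S$ from $\mathbf S$ and select a positive atom containing $S$ or,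 if there is none, an arithmetic expression $S=\varphi(\mathbf Y)$, adding $\mathbf Y$ to $\mathbf S$, until $\mathbf S$ is empty. 2. *Weak constraint.* Replace $\bot\leftarrow B\,[k:\mathbf t]$ by the rule $temp(k,\mathbf t)\leftarrow B$ and the weak constraint $\bot\leftarrow temp(k,\mathbf t)\,[k:\mathbf t]$, with $temp$ fresh. 3. *Aggregate.* In a rule, replace an aggregate $t\preccurlyeq\#agg\{\mathbf t:\phi\}$ (possibly nested in others) by $t\preccurlyeq\#agg\{\mathbf t:\psi,temp(\mathbf u)\}$ and add the rule $temp(\mathbf u)\leftarrow\overline\psi$, where $temp$ is fresh, $\phi=\psi\uplus\overline\psi$, no variable of $\overline\psi$ comes from outside the aggregate, and $\mathbf u$ is a sequence of terms over variables that come from outside or belong to the scope of this aggregate (i.e. occur in $\mathbf t$ or in $\phi$ outside the braces of nested aggregates), containing all scope variables that occur in $\overline\psi$ and also in $\psi$ or $\mathbf t$. Variables that are unsafe in the new rule get fresh domain predicates as in 1, where the $A_X$ are selected from some set of elements of $\phi$ and of the bodies surrounding the aggregate, such that aggregates are non-recursive in the resulting program. **Theorem.** Let $P$ be a safe program with non-recursive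 aggregates. (a) If the algorithm rewrites $P$ into $Q$, then $Q$ is safe and has non-recursive aggregates; the map that removes from an interpretation all atoms whose predicate does not occur in $P$ is a bijection from the answer sets of $Q$ onto the answer sets of $P$; it preserves weights, that is $w_Q(I)=w_P(I|_P)$ for every answer set $I$ of $Q$; and it restricts to a bijection from the optimal answer sets of $Q$ onto those of $P$. (b) For every rule of $P$ and every tree decomposition of it as in 1, step 1 can be carried out (in particular the required sets $A_X$ exist). (c) For every aggregate in the body of a rule of $P$ (not nested in another one) and all $\psi,\overline\psi,\mathbf u$ as in 3 such that the variables of $\mathbf u$ and those of $\overline\psi$ outside the braces of nested aggregates are safe with respect to $\phi$ alone, step 3 can be carried out. -/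

import Mathlib

/-! Answer set programs with disjunctive heads, default negation, arithmetic expressions, (nested)
aggregates and weak constraints; their answer sets; and the rule decomposition algorithm. -/

namespace Asp

/-! ### Syntax -/

/-- Constants: the integers and the symbolic constants, with the total order in which the integers
precede the symbolic constants. Different constants denote different values. -/
abbrev Const : Type := ℤ ⊕ₗ String

/-- The constant that is the integer `z`. -/
abbrev Const.int (z : ℤ) : Const := toLex (Sum.inl z)

/-- The integer that a constant is, if it is one. -/
def Const.toInt? (c : Const) : Option ℤ := (ofLex c).getLeft?

abbrev Var : Type := ℕ

abbrev Pred : Type := ℕ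

inductive Term where
  | var (x : Var)
  | const (c : Const)

def Term.vars : Term → Finset Var
  | .var x => {x}
  | .const _ => ∅

/-- The variables of a sequence of terms. -/
def termsVars (ts : List Term) : Finset Var := ts.foldr (fun t s => t.vars ∪ s) ∅

structure Atom where
  pred : Pred
  args : List Term

def Atom.vars (a : Atom) : Finset Var := termsVars a.args

/-- Mathematical expressions over variables and constant numbers. -/
inductive Expr where
  | num (z : ℤ)
  | var (x : Var)
  | add (a b : Expr)
  | sub (a b : Expr)
  | mul (a b : Expr)
  | div (a b : Expr)

def Expr.vars : Expr → Finset Var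
  | .num _ => ∅
  | .var x => {x}
  | .add a b | .sub a b | .mul a b | .div a b => a.vars ∪ b.vars

/-- The builtin comparison relations. -/
inductive Cmp where
  | lt | le | eq | ne | ge | gt

inductive AggFun where
  | sum | count | max | min

/-- Body elements: positive and negative literals, arithmetic expressions `lhs = rhs`, and aggregate
expressions `t ≼ #agg { tuple : body }`. Conjunctions are written as lists; neither order nor
multiplicity matters for the semantics. -/
inductive Elt where
  | pos (a : Atom)
  | neg (a : Atom)
  | arith (lhs : Term) (rhs : Expr)
  | agg (t : Term) (cmp : Cmp) (f : AggFun) (tuple : List Term) (body : List Elt)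

mutual
/-- All variables of a body element, including those inside aggregates. -/
def Elt.vars : Elt → Finset Var
  | .pos a => a.vars
  | .neg a => a.vars
  | .arith l e => l.vars ∪ e.vars
  | .agg t _ _ tup body => t.vars ∪ termsVars tup ∪ bodyVars body
def bodyVars : List Elt → Finset Var
  | [] => ∅
  | e :: es => e.vars ∪ bodyVars es
end

mutual
/-- All predicates of a body element, including those inside aggregates. -/
def Elt.preds : Elt → Finset Pred
  | .pos a => {a.pred}
  | .neg a => {a.pred}
  | .arith _ _ => ∅
  | .agg _ _ _ _ body => bodyPreds body
def bodyPreds : List Elt → Finset Pred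
  | [] => ∅
  | e :: es => e.preds ∪ bodyPreds es
end

/-- The variables of a body element that occur outside the braces of an aggregate. -/
def Elt.outerVars : Elt → Finset Var
  | .pos a => a.vars
  | .neg a => a.vars
  | .arith l e => l.vars ∪ e.vars
  | .agg t _ _ _ _ => t.vars

def outerVars (es : List Elt) : Finset Var := es.foldr (fun e s => e.outerVars ∪ s) ∅

/-- The variables that an aggregate `#agg { tup : body }` has in its own scope. Those of them that
do not come from the surroundings are its local variables. Variables that occur only inside a nested
aggregate belong to the scope of the latter. -/
def aggScope (tup : List Term) (body : List Elt) : Finset Var := termsVars tup ∪ outerVars body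

/-- A rule: the disjunction of the head atoms follows from the conjunction of the body elements. -/
structure Rule where
  head : List Atom
  body : List Elt

def atomsVars (as : List Atom) : Finset Var := as.foldr (fun a s => a.vars ∪ s) ∅

/-- The predicates of a list of atoms. -/
def atomsPreds (as : List Atom) : Finset Pred := (as.map Atom.pred).toFinset

/-- The global variables of a rule: those occurring in it outside the braces of aggregates. -/
def Rule.globals (r : Rule) : Finset Var := atomsVars r.head ∪ outerVars r.body

def Rule.preds (r : Rule) : Finset Pred := atomsPreds r.head ∪ bodyPreds r.body

/-- A weak constraint `⊥ ← body [weight : tuple]`. -/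
structure WeakConstraint where
  body : List Elt
  weight : Term
  tuple : List Term

def WeakConstraint.globals (w : WeakConstraint) : Finset Var :=
  termsVars (w.weight :: w.tuple) ∪ outerVars w.body

/-- A finite set of rules together with a finite set of weak constraints, listed. -/
structure Program where
  rules : List Rule
  weak : List WeakConstraint

/-- The schema of a program: the predicates that appear in it. -/
def Program.preds (P : Program) : Finset Pred :=
  P.rules.foldr (fun r s => r.preds ∪ s) ∅ ∪ P.weak.foldr (fun w s => bodyPreds w.body ∪ s) ∅

/-! ### Safety -/

/-- `Bound B K x`: the variable `x` is made safe by the positive atoms and arithmetic expressions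
among the body elements `B`, given that the variables in `K` are safe already. -/
inductive Bound (B : List Elt) (K : Finset Var) : Var → Prop
  | known {x : Var} : x ∈ K → Bound B K x
  | pos {a : Atom} {x : Var} : Elt.pos a ∈ B → x ∈ a.vars → Bound B K x
  | arith {x : Var} {e : Expr} :
      Elt.arith (.var x) e ∈ B → (∀ y ∈ e.vars, Bound B K y) → Bound B K x

mutual
/-- All aggregates in a body element are safe, where the variables in `G` come from outside. -/
def Elt.AggSafe (G : Finset Var) : Elt → Prop
  | .pos _ => True
  | .neg _ => True
  | .arith _ _ => True
  | .agg _ _ _ tup body =>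
      (∀ x ∈ aggScope tup body, Bound body G x) ∧ bodyAggSafe (G ∪ aggScope tup body) body
def bodyAggSafe (G : Finset Var) : List Elt → Prop
  | [] => True
  | e :: es => e.AggSafe G ∧ bodyAggSafe G es
end

def Rule.Safe (r : Rule) : Prop :=
  (∀ x ∈ r.globals, Bound r.body ∅ x) ∧ bodyAggSafe r.globals r.body

def WeakConstraint.Safe (w : WeakConstraint) : Prop :=
  (∀ x ∈ w.globals, Bound w.body ∅ x) ∧ bodyAggSafe w.globals w.body

def Program.Safe (P : Program) : Prop := (∀ r ∈ P.rules, r.Safe) ∧ ∀ w ∈ P.weak, w.Safe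

/-! ### Aggregates are not recursive -/

/-- The predicates that occur inside an aggregate of the body. -/
def aggPreds (B : List Elt) : Set Pred :=
  {p | ∃ t cmp f tup body, Elt.agg t cmp f tup body ∈ B ∧ p ∈ bodyPreds body}

/-- There is no recursion through aggregates: the predicates can be stratified such that each head
predicate of a rule is at least as high as the predicates of the positive body and strictly higher
than the predicates inside the aggregates of the rule. -/
def Program.NonrecursiveAggregates (P : Program) : Prop :=
  ∃ level : Pred → ℕ, ∀ r ∈ P.rules, ∀ h ∈ r.head,
    (∀ a : Atom, Elt.pos a ∈ r.body → level a.pred ≤ level h.pred) ∧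
    ∀ p ∈ aggPreds r.body, level p < level h.pred

/-! ### Semantics -/

/-- Ground atoms: a predicate applied to a sequence of constants. -/
abbrev GroundAtom : Type := Pred × List Const

/-- An interpretation is the set of the ground atoms that are true. -/
abbrev Interp : Type := Set GroundAtom

/-- Ground substitutions. The instances of a rule are formed over all constants, since arithmetic
leads out of the constants that are written in the program. -/
abbrev Subst : Type := Var → Const

def Term.subst (s : Subst) : Term → Const
  | .var x => s x
  | .const c => c

def Atom.subst (s : Subst) (a : Atom) : GroundAtom := (a.pred, a.args.map (Term.subst s))

/-- The value of a ground expression; undefined if a variable is not mapped to an integer, or on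
division by zero. Division is integer division that rounds towards zero. -/
def Expr.eval (s : Subst) : Expr → Option ℤ
  | .num z => some z
  | .var x => (s x).toInt?
  | .add a b => do return (← a.eval s) + (← b.eval s)
  | .sub a b => do return (← a.eval s) - (← b.eval s)
  | .mul a b => do return (← a.eval s) * (← b.eval s)
  | .div a b => do
      let y ← b.eval s
      if y = 0 then none else return (← a.eval s).tdiv y

/-- Results of aggregate functions: constants, and the values `⊥` and `⊤` below and above all
constants. -/
abbrev AggValue : Type := WithBot (WithTop Const)

def Cmp.Rel : Cmp → AggValue → AggValue → Prop
  | .lt, a, b => a < b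
  | .le, a, b => a ≤ b
  | .eq, a, b => a = b
  | .ne, a, b => a ≠ b
  | .ge, a, b => b ≤ a
  | .gt, a, b => b < a

/-- The contribution of a tuple to a sum: its first component (`0` if this is not an integer). -/
def tupleWeight : List Const → ℤ
  | [] => 0
  | c :: _ => c.toInt?.getD 0

open Classical in
/-- The sum of the first components of a set of tuples; undefined if infinitely many of them are
nonzero. -/
noncomputable def tupleSum (T : Set (List Const)) : Option ℤ :=
  if {c ∈ T | tupleWeight c ≠ 0}.Finite then some (∑ᶠ c ∈ T, tupleWeight c) else none

/-- The constants in the first position of the tuples of a set. -/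
def firsts (T : Set (List Const)) : Set Const := {c | ∃ l, c :: l ∈ T}

open Classical in
/-- The aggregate functions on sets of tuples. The maximum of the empty set is `⊥` and its minimum
is `⊤`; an infinite set has the cardinality `⊤`, and the maximum `⊤` (minimum `⊥`) if it has no
greatest (least) element. -/
noncomputable def AggFun.eval (T : Set (List Const)) : AggFun → Option AggValue
  | .sum => (tupleSum T).map fun z => ((Const.int z : WithTop Const) : AggValue)
  | .count => if T.Finite then some ((Const.int (T.ncard : ℤ) : WithTop Const) : AggValue)
      else some ((⊤ : WithTop Const) : AggValue)
  | .max =>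
      if firsts T = ∅ then some ⊥
      else if h : ∃ c, IsGreatest (firsts T) c then some ((h.choose : WithTop Const) : AggValue)
      else some ((⊤ : WithTop Const) : AggValue)
  | .min =>
      if firsts T = ∅ then some ((⊤ : WithTop Const) : AggValue)
      else if h : ∃ c, IsLeast (firsts T) c then some ((h.choose : WithTop Const) : AggValue)
      else some ⊥

mutual
/-- `Elt.Holds I G s e`: the instance of `e` under `s` is true in `I`, where `G` are the variables
that come from outside of `e`. An aggregate collects the instances of its tuple over all
substitutions that agree with `s` on `G` and make its body true. -/
def Elt.Holds (I : Interp) (G : Finset Var) (s : Subst) : Elt → Prop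
  | .pos a => a.subst s ∈ I
  | .neg a => a.subst s ∉ I
  | .arith l e => ∃ z : ℤ, e.eval s = some z ∧ l.subst s = Const.int z
  | .agg t cmp f tup body =>
      ∃ v : AggValue,
        f.eval {c | ∃ s' : Subst, (∀ x ∈ G, s' x = s x) ∧
          bodyHolds I (G ∪ aggScope tup body) s' body ∧ c = tup.map (Term.subst s')} = some v ∧
        cmp.Rel ((t.subst s : WithTop Const) : AggValue) v
/-- All of the body elements are true. -/
def bodyHolds (I : Interp) (G : Finset Var) (s : Subst) : List Elt → Prop
  | [] => True
  | e :: es => e.Holds I G s ∧ bodyHolds I G s es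
end

def Elt.IsPos : Elt → Prop
  | .pos _ => True
  | _ => False

def Elt.IsNeg : Elt → Prop
  | .neg _ => True
  | _ => False

/-- `I` is a classical model: it satisfies every instance of every rule. -/
def Program.Model (P : Program) (I : Interp) : Prop :=
  ∀ r ∈ P.rules, ∀ s : Subst, bodyHolds I r.globals s r.body → ∃ h ∈ r.head, h.subst s ∈ I

/-- `J` is a model of the reduct with respect to `I`. The reduct keeps the instances of the rules
in which everything but the positive literals (that is, negative literals, arithmetic expressions
and aggregates) is true in `I`, and removes the negative literals from them. For programs without
arithmetic and aggregates this is the Gelfond-Lifschitz reduct. -/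
def Program.ReductModel (P : Program) (I J : Interp) : Prop :=
  ∀ r ∈ P.rules, ∀ s : Subst,
    (∀ e ∈ r.body, ¬ e.IsPos → e.Holds I r.globals s) →
    (∀ e ∈ r.body, ¬ e.IsNeg → e.Holds J r.globals s) →
    ∃ h ∈ r.head, h.subst s ∈ J

/-- Answer sets: models over the schema of the program such that no proper subset is a model of the
reduct. -/
def Program.AnswerSet (P : Program) (I : Interp) : Prop :=
  (∀ a ∈ I, a.1 ∈ P.preds) ∧ P.Model I ∧ ∀ J, J ⊂ I → ¬ P.ReductModel I J

/-- The instances of the annotations of the weak constraints whose body is true in `I`. -/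
def Program.costTuples (P : Program) (I : Interp) : Set (List Const) :=
  {c | ∃ w ∈ P.weak, ∃ s : Subst, bodyHolds I w.globals s w.body ∧
    c = (w.weight :: w.tuple).map (Term.subst s)}

/-- The total weight of an interpretation (undefined if it is an infinite sum). -/
noncomputable def Program.weight (P : Program) (I : Interp) : Option ℤ := tupleSum (P.costTuples I)

/-- Optimal answer sets: those of minimal weight. -/
def Program.OptimalAnswerSet (P : Program) (I : Interp) : Prop :=
  P.AnswerSet I ∧ ∃ z, P.weight I = some z ∧
    ∀ J, P.AnswerSet J → ∀ z', P.weight J = some z' → z ≤ z'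

/-- The atoms of an interpretation over the given predicates. -/
def restrict (S : Finset Pred) (I : Interp) : Interp := {a ∈ I | a.1 ∈ S}

/-! ### Tree decompositions of rules -/

/-- The rule graph: two global variables are adjacent if they occur together in the head, or in one
body element (a literal, an arithmetic expression or an aggregate). Its vertices are the global
variables of the rule. -/
def Rule.graph (r : Rule) : SimpleGraph Var :=
  SimpleGraph.fromRel fun x y => x ∈ r.globals ∧ y ∈ r.globals ∧
    ((x ∈ atomsVars r.head ∧ y ∈ atomsVars r.head) ∨ ∃ e ∈ r.body, x ∈ e.vars ∧ y ∈ e.vars)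

/-- A finite rooted tree, given by the parent of each node. The parent of the root is set to the
root itself. -/
structure RootedTree where
  size : ℕ
  root : Fin size
  parent : Fin size → Fin size
  parent_root : parent root = root
  reach : ∀ n, ∃ j : ℕ, parent^[j] n = root

def RootedTree.graph (T : RootedTree) : SimpleGraph (Fin T.size) :=
  SimpleGraph.fromRel fun m n => T.parent m = n

/-- The list of the children of a node. -/
def RootedTree.children (T : RootedTree) (n : Fin T.size) : List (Fin T.size) :=
  (List.finRange T.size).filter fun m => m ≠ T.root ∧ T.parent m = n

/-- Tree decompositions (of any width) of the graph with the vertex set `V` and the edges of `E`. -/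
structure TreeDecomposition (V : Finset Var) (E : SimpleGraph Var) where
  tree : RootedTree
  bag : Fin tree.size → Finset Var
  bag_subset : ∀ n, bag n ⊆ V
  vertex : ∀ x ∈ V, ∃ n, x ∈ bag n
  edge : ∀ x y, E.Adj x y → ∃ n, x ∈ bag n ∧ y ∈ bag n
  path : ∀ (m n : Fin tree.size) (p : tree.graph.Walk m n), p.IsPath →
    ∀ k ∈ p.support, bag m ∩ bag n ⊆ bag k

/-- Tree decompositions of a rule; all head variables have to be in the bag of the root. -/
structure Rule.Decomposition (r : Rule) extends TreeDecomposition r.globals r.graph where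
  head_subset : atomsVars r.head ⊆ bag tree.root

/-! ### Domain predicates -/

/-- Greedy selection, from the body elements `B`, of a set that makes the variables in `S` safe. As
long as `S` is not empty, a variable is taken out of `S`; a positive atom with this variable is
selected or, if there is none, an arithmetic expression that defines the variable, whose right-hand
side variables are then added to `S`. Any order and any choice of the elements is allowed. -/
inductive GreedySelection (B : List Elt) : Finset Var → List Elt → Prop
  | done : GreedySelection B ∅ []
  | atom {S : Finset Var} {x : Var} {a : Atom} {A : List Elt} :
      x ∈ S → Elt.pos a ∈ B → x ∈ a.vars →
      GreedySelection B (S \ {x}) A → GreedySelection B S (Elt.pos a :: A)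
  | arith {S : Finset Var} {x : Var} {e : Expr} {A : List Elt} :
      x ∈ S → (∀ a : Atom, Elt.pos a ∈ B → x ∉ a.vars) → Elt.arith (.var x) e ∈ B →
      GreedySelection B (S \ {x} ∪ e.vars) A →
      GreedySelection B S (Elt.arith (.var x) e :: A)

/-- The set of variables `X`, as a sequence of terms. -/
def varTerms (X : Finset Var) : List Term := (X.sort (· ≤ ·)).map Term.var

/-- The atoms `dom_x(x)` for the variables in `X`. -/
def domAtoms (dom : Var → Pred) (X : Finset Var) : List Elt :=
  (X.sort (· ≤ ·)).map fun x => Elt.pos ⟨dom x, [.var x]⟩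

/-- The rules `dom_x(x) ← A_x` for the variables in `X`. -/
def domRules (dom : Var → Pred) (A : Var → List Elt) (X : Finset Var) : List Rule :=
  (X.sort (· ≤ ·)).map fun x => ⟨[⟨dom x, [.var x]⟩], A x⟩

open Classical in
/-- The global variables that make a rule unsafe. -/
noncomputable def Rule.unsafeVars (r : Rule) : Finset Var :=
  r.globals.filter fun x => ¬ Bound r.body ∅ x

open Classical in
/-- The variables of negative literals among `B` that are in no positive literal among `B`. -/
noncomputable def negVars (B : List Elt) : Finset Var :=
  (outerVars B).filter fun x =>
    (∃ a : Atom, Elt.neg a ∈ B ∧ x ∈ a.vars) ∧ ∀ b : Atom, Elt.pos b ∈ B → x ∉ b.vars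

/-! ### Decomposition of a rule -/

section Decompose

variable (r : Rule) (d : r.Decomposition) (temp : Fin d.tree.size → Pred)

/-- The body elements of the rule whose global variables are contained in the bag of `n`. -/
def Rule.bagElts (n : Fin d.tree.size) : List Elt :=
  r.body.filter fun e => e.vars ∩ r.globals ⊆ d.bag n

/-- The atom `temp_n(Y_n)`, where `Y_n` are the common variables of `n` and its parent. -/
def Rule.tempAtom (n : Fin d.tree.size) : Atom :=
  ⟨temp n, varTerms (d.bag n ∩ d.bag (d.tree.parent n))⟩

/-- The rule of node `n` before domain predicates are added: from the elements of the bag and the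
temporary atoms of the children follows `temp_n(Y_n)`; for the root, the head of the rule. -/
def Rule.preNodeRule (n : Fin d.tree.size) : Rule where
  head := if n = d.tree.root then r.head else [r.tempAtom d temp n]
  body := r.bagElts d n ++ (d.tree.children n).map fun m => Elt.pos (r.tempAtom d temp m)

/-- The variables for which the rule of node `n` gets a domain predicate: those of the negative
literals in the bag that occur in no positive literal in the bag, and those that would otherwise
be unsafe. -/
noncomputable def Rule.domVars (n : Fin d.tree.size) : Finset Var :=
  negVars (r.bagElts d n) ∪ (r.preNodeRule d temp n).unsafeVars

noncomputable def Rule.nodeRule (dom : Var → Pred) (n : Fin d.tree.size) : Rule where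
  head := (r.preNodeRule d temp n).head
  body := (r.preNodeRule d temp n).body ++ domAtoms dom (r.domVars d temp n)

/-- All variables for which a domain predicate is used. -/
noncomputable def Rule.allDomVars : Finset Var := Finset.univ.biUnion (r.domVars d temp)

end Decompose

/-- `R` are rules into which the algorithm splits `r` along the tree decomposition `d`. The
predicates `temp_n` and `dom_x` do not belong to `used` and are pairwise different. -/
def Rule.DecomposesTo (used : Finset Pred) (r : Rule) (d : r.Decomposition) (R : List Rule) :
    Prop :=
  ∃ (temp : Fin d.tree.size → Pred) (dom : Var → Pred) (A : Var → List Elt),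
    Function.Injective temp ∧ (∀ n, temp n ∉ used) ∧
    Set.InjOn dom (r.globals : Set Var) ∧ (∀ x ∈ r.globals, dom x ∉ used ∧ ∀ n, temp n ≠ dom x) ∧
    (∀ x ∈ r.allDomVars d temp, GreedySelection r.body {x} (A x)) ∧
    R = (List.finRange d.tree.size).map (r.nodeRule d temp dom) ++
      domRules dom A (r.allDomVars d temp)

/-! ### Weak constraints -/

/-- The rule `temp(k, t) ← body` for a weak constraint `⊥ ← body [k : t]`. -/
def WeakConstraint.tempRule (w : WeakConstraint) (temp : Pred) : Rule :=
  ⟨[⟨temp, w.weight :: w.tuple⟩], w.body⟩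

/-- The weak constraint `⊥ ← temp(k, t) [k : t]`. -/
def WeakConstraint.tempConstraint (w : WeakConstraint) (temp : Pred) : WeakConstraint :=
  ⟨[.pos ⟨temp, w.weight :: w.tuple⟩], w.weight, w.tuple⟩

/-! ### Aggregates -/

/-- An admissible way of splitting the aggregate `#agg { tup : φ }`, where the variables in `G` come
from outside: `ψ` and `ψ'` are a partition of `φ`, all elements with a variable from outside are in
`ψ`, and the arguments `args` of the temporary predicate include the variables of `ψ'` that are
relevant for the rest of the aggregate (and possibly further ones, for example all of `tup`). -/
structure AggPartition (G : Finset Var) (tup : List Term) (φ ψ ψ' : List Elt) (args : List Term) :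
    Prop where
  perm : φ.Perm (ψ ++ ψ')
  inner : Disjoint (bodyVars ψ') G
  args_subset : termsVars args ⊆ G ∪ aggScope tup φ
  relevant : bodyVars ψ' ∩ aggScope tup φ ∩ (bodyVars ψ ∪ termsVars tup) ⊆ termsVars args

/-- The rule `temp(args) ← ψ'` before domain predicates are added. -/
def preAggRule (temp : Pred) (args : List Term) (ψ' : List Elt) : Rule := ⟨[⟨temp, args⟩], ψ'⟩

/-- `R` are the rules that define the temporary predicate `temp` for `ψ'`: the rule
`temp(args) ← ψ'`, made safe by domain predicates, which are defined by elements selected from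
`B`. -/
def AggRules (used : Finset Pred) (B ψ' : List Elt) (args : List Term) (temp : Pred)
    (R : List Rule) : Prop :=
  ∃ (dom : Var → Pred) (A : Var → List Elt), temp ∉ used ∧
    Set.InjOn dom ((preAggRule temp args ψ').unsafeVars : Set Var) ∧
    (∀ x ∈ (preAggRule temp args ψ').unsafeVars,
      dom x ∉ used ∧ temp ≠ dom x ∧ GreedySelection B {x} (A x)) ∧
    R = ⟨[⟨temp, args⟩], ψ' ++ domAtoms dom (preAggRule temp args ψ').unsafeVars⟩ ::
      domRules dom A (preAggRule temp args ψ').unsafeVars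

/-- `AggRewrite used G C e e' R`: by splitting one aggregate, which is `e` or is nested in `e`, the
body element `e` turns into `e'`, and the rules `R` are generated. `G` are the variables that come
from outside of `e`, and `C` are the elements of the body in which `e` occurs and of the bodies
around it. Domain predicates are defined by elements of the aggregate or of `C`. -/
inductive AggRewrite (used : Finset Pred) :
    Finset Var → List Elt → Elt → Elt → List Rule → Prop
  | here {G : Finset Var} {C B : List Elt} {t : Term} {cmp : Cmp} {f : AggFun} {tup : List Term}
      {φ ψ ψ' : List Elt} {args : List Term} {temp : Pred} {R : List Rule} :
      AggPartition G tup φ ψ ψ' args → B ⊆ C ++ φ → AggRules used B ψ' args temp R →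
      AggRewrite used G C (.agg t cmp f tup φ) (.agg t cmp f tup (ψ ++ [.pos ⟨temp, args⟩])) R
  | inside {G : Finset Var} {C : List Elt} {t : Term} {cmp : Cmp} {f : AggFun} {tup : List Term}
      {l₁ l₂ : List Elt} {e e' : Elt} {R : List Rule} :
      AggRewrite used (G ∪ aggScope tup (l₁ ++ e :: l₂)) (C ++ (l₁ ++ e :: l₂)) e e' R →
      AggRewrite used G C (.agg t cmp f tup (l₁ ++ e :: l₂)) (.agg t cmp f tup (l₁ ++ e' :: l₂)) R

/-! ### The algorithm -/

/-- One step of the algorithm: a rule is decomposed, a weak constraint is replaced, or an aggregate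
is split. In the last case the selection of the elements that define the domain predicates must not
introduce recursion through aggregates, which the language excludes. -/
inductive Step : Program → Program → Prop
  | rule {l₁ l₂ : List Rule} {W : List WeakConstraint} {r : Rule} {d : r.Decomposition}
      {R : List Rule} :
      r.DecomposesTo (Program.preds ⟨l₁ ++ r :: l₂, W⟩) d R →
      Step ⟨l₁ ++ r :: l₂, W⟩ ⟨l₁ ++ R ++ l₂, W⟩
  | weak {l : List Rule} {W₁ W₂ : List WeakConstraint} {w : WeakConstraint} {temp : Pred} :
      temp ∉ Program.preds ⟨l, W₁ ++ w :: W₂⟩ →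
      Step ⟨l, W₁ ++ w :: W₂⟩ ⟨w.tempRule temp :: l, W₁ ++ w.tempConstraint temp :: W₂⟩
  | aggregate {l₁ l₂ : List Rule} {W : List WeakConstraint} {H : List Atom} {b₁ b₂ : List Elt}
      {e e' : Elt} {R : List Rule} :
      AggRewrite (Program.preds ⟨l₁ ++ ⟨H, b₁ ++ e :: b₂⟩ :: l₂, W⟩)
        (Rule.globals ⟨H, b₁ ++ e :: b₂⟩) (b₁ ++ e :: b₂) e e' R →
      Program.NonrecursiveAggregates ⟨l₁ ++ ⟨H, b₁ ++ e' :: b₂⟩ :: R ++ l₂, W⟩ →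
      Step ⟨l₁ ++ ⟨H, b₁ ++ e :: b₂⟩ :: l₂, W⟩ ⟨l₁ ++ ⟨H, b₁ ++ e' :: b₂⟩ :: R ++ l₂, W⟩

/-- `Rewrites P Q`: the algorithm can rewrite `P` into `Q`. All rules, weak constraints and
aggregates may be treated, in any order, including those that arise on the way. -/
def Rewrites : Program → Program → Prop := Relation.ReflTransGen Step

end Asp

namespace Asp

/-! ### Variables, predicates and induction -/

-- Every step of the algorithm is a definitional extension: it adds definite rules for fresh
-- predicates and replaces old rules by ones that are equivalent once the fresh predicates have
-- their least interpretation. Safety, stratification, the bijection and weights are proved for one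
-- step and composed (`Program.Refines.trans`).
--
-- The obstacle is that the reduct tests aggregates in `J` as well as in `I`, which is not monotone
-- in `J`. Stratification removes it. Given a reduct model `J ⊂ I`, add to `J` all atoms of `I`
-- above the lowest level where the two differ; the result is still a proper subset of `I`, and it
-- satisfies the rules even if aggregates are tested in `I` alone (`exists_closed`). Hence answer
-- sets are the interpretations that are minimal for a condition in which only positive literals
-- depend on `J` (`answerSet_iff`).
--
-- In this form, let `D` be definite rules with fresh heads whose tests use old predicates only. The
-- fresh atoms are then determined by the old ones: an answer set of the new program is the closure
-- under `D` of its restriction, and minimality transfers in both directions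
-- (`DefinitionalExtension.bijOn`).
--
-- It remains to see that replaced rules are equivalent. For a tree decomposition, the global
-- variables of a body element form a clique, which lies in one bag, so no element is lost. If the
-- body of the rule is true, so are the node rules, from the leaves upwards. Conversely, the root
-- rule yields substitutions for all nodes that agree on common variables of neighbours, and
-- connectedness glues them into one (`exists_fires_of_root`). For an aggregate, a solution of `ψ`
-- with the temporary atom and a solution of `ψ'` agree on the arguments, hence on everything they
-- share within the scope, and can be glued (`AggRules.holds_iff`). Domain atoms never exclude a
-- solution, as their definitions are parts of bodies that are true anyway. Weak constraints change
-- the weights only, and `temp` holds exactly of the old cost tuples.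

theorem Elt.induction {motive : Elt → Prop} (pos : ∀ a, motive (.pos a))
    (neg : ∀ a, motive (.neg a)) (arith : ∀ l e, motive (.arith l e))
    (agg : ∀ t cmp f tup body, (∀ e ∈ body, motive e) → motive (.agg t cmp f tup body))
    (e : Elt) : motive e :=
  Elt.rec (motive_1 := motive) (motive_2 := fun l => ∀ e ∈ l, motive e) pos neg arith
    (fun t cmp f tup body h => agg t cmp f tup body h) (by simp)
    (fun e l he hl => by simpa using ⟨he, hl⟩) e

theorem mem_bodyVars {x : Var} {B : List Elt} : x ∈ bodyVars B ↔ ∃ e ∈ B, x ∈ e.vars := by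
  induction B with
  | nil => simp [bodyVars]
  | cons e B ih => simp [bodyVars, ih]

theorem mem_bodyPreds {p : Pred} {B : List Elt} : p ∈ bodyPreds B ↔ ∃ e ∈ B, p ∈ e.preds := by
  induction B with
  | nil => simp [bodyPreds]
  | cons e B ih => simp [bodyPreds, ih]

theorem mem_outerVars {x : Var} {B : List Elt} : x ∈ outerVars B ↔ ∃ e ∈ B, x ∈ e.outerVars := by
  induction B with
  | nil => simp [outerVars]
  | cons e B ih => simp only [outerVars] at ih; simp [outerVars, ih]

theorem mem_termsVars {x : Var} {ts : List Term} : x ∈ termsVars ts ↔ ∃ t ∈ ts, x ∈ t.vars := by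
  induction ts with
  | nil => simp [termsVars]
  | cons t ts ih => simp only [termsVars] at ih; simp [termsVars, ih]

theorem mem_atomsVars {x : Var} {as : List Atom} : x ∈ atomsVars as ↔ ∃ a ∈ as, x ∈ a.vars := by
  induction as with
  | nil => simp [atomsVars]
  | cons a as ih => simp only [atomsVars] at ih; simp [atomsVars, ih]

theorem mem_atomsPreds {p : Pred} {as : List Atom} : p ∈ atomsPreds as ↔ ∃ a ∈ as, a.pred = p := by
  simp [atomsPreds]

theorem Program.mem_preds {P : Program} {p : Pred} :
    p ∈ P.preds ↔ (∃ r ∈ P.rules, p ∈ r.preds) ∨ ∃ w ∈ P.weak, p ∈ bodyPreds w.body := by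
  have h1 (l : List Rule) : p ∈ l.foldr (fun r s => r.preds ∪ s) ∅ ↔ ∃ r ∈ l, p ∈ r.preds := by
    induction l with
    | nil => simp
    | cons a l ih => simp [ih]
  have h2 (l : List WeakConstraint) :
      p ∈ l.foldr (fun w s => bodyPreds w.body ∪ s) ∅ ↔ ∃ w ∈ l, p ∈ bodyPreds w.body := by
    induction l with
    | nil => simp
    | cons a l ih => simp [ih]
  rw [Program.preds, Finset.mem_union, h1, h2]

theorem Elt.outerVars_subset (e : Elt) : e.outerVars ⊆ e.vars := by
  cases e with
  | agg t cmp f tup body => intro x hx; simp_all [Elt.outerVars, Elt.vars]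
  | _ => simp [Elt.outerVars, Elt.vars]

theorem outerVars_subset_bodyVars (B : List Elt) : outerVars B ⊆ bodyVars B := by
  intro x hx
  obtain ⟨e, he, hx⟩ := mem_outerVars.1 hx
  exact mem_bodyVars.2 ⟨e, he, e.outerVars_subset hx⟩

theorem outerVars_append (B B' : List Elt) : outerVars (B ++ B') = outerVars B ∪ outerVars B' := by
  ext x; simp [mem_outerVars, or_and_right, exists_or]

theorem bodyPreds_append (B B' : List Elt) :
    bodyPreds (B ++ B') = bodyPreds B ∪ bodyPreds B' := by
  ext x; simp [mem_bodyPreds, or_and_right, exists_or]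

theorem aggScope_subset (t : Term) (cmp : Cmp) (f : AggFun) (tup : List Term) (body : List Elt) :
    aggScope tup body ⊆ (Elt.agg t cmp f tup body).vars := by
  intro x hx
  simp only [aggScope, Finset.mem_union] at hx
  simp only [Elt.vars, Finset.mem_union]
  exact hx.elim (fun h => .inl (.inr h)) fun h => .inr (outerVars_subset_bodyVars _ h)

theorem outerVars_subset_globals {r : Rule} {e : Elt} (he : e ∈ r.body) :
    e.outerVars ⊆ r.globals := fun _ hx =>
  Finset.mem_union_right _ (mem_outerVars.2 ⟨e, he, hx⟩)

theorem mem_varTerms_vars {x : Var} {X : Finset Var} : x ∈ termsVars (varTerms X) ↔ x ∈ X := by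
  simp [mem_termsVars, varTerms, Term.vars]

/-! ### Substitutions -/

theorem Term.subst_congr {s s' : Subst} {t : Term} (h : ∀ x ∈ t.vars, s x = s' x) :
    t.subst s = t.subst s' := by
  cases t <;> simp_all [Term.subst, Term.vars]

theorem map_subst_congr {s s' : Subst} {ts : List Term} (h : ∀ x ∈ termsVars ts, s x = s' x) :
    ts.map (Term.subst s) = ts.map (Term.subst s') :=
  List.map_congr_left fun t ht => Term.subst_congr fun x hx => h x (mem_termsVars.2 ⟨t, ht, hx⟩)

theorem Atom.subst_congr {s s' : Subst} {a : Atom} (h : ∀ x ∈ a.vars, s x = s' x) :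
    a.subst s = a.subst s' := by
  simp only [Atom.subst, map_subst_congr h]

theorem eq_of_map_subst_eq {s s' : Subst} {ts : List Term}
    (h : ts.map (Term.subst s) = ts.map (Term.subst s')) {x : Var} (hx : x ∈ termsVars ts) :
    s x = s' x := by
  obtain ⟨t, ht, hx⟩ := mem_termsVars.1 hx
  have := List.map_inj_left.1 h t ht
  cases t <;> simp_all [Term.subst, Term.vars]

theorem Expr.eval_congr {s s' : Subst} {e : Expr} (h : ∀ x ∈ e.vars, s x = s' x) :
    e.eval s = e.eval s' := by
  induction e with
  | num => rfl
  | var x => simp_all [Expr.eval, Expr.vars]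
  | _ a b iha ihb =>
    simp only [Expr.vars, Finset.mem_union] at h
    simp only [Expr.eval, iha fun x hx => h x (.inl hx), ihb fun x hx => h x (.inr hx)]

/-! ### Truth of body elements -/

theorem bodyHolds_iff {I : Interp} {G : Finset Var} {s : Subst} {B : List Elt} :
    bodyHolds I G s B ↔ ∀ e ∈ B, e.Holds I G s := by
  induction B with
  | nil => simp [bodyHolds]
  | cons e B ih => simp [bodyHolds, ih]

theorem bodyAggSafe_iff {G : Finset Var} {B : List Elt} :
    bodyAggSafe G B ↔ ∀ e ∈ B, e.AggSafe G := by
  induction B with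
  | nil => simp [bodyAggSafe]
  | cons e B ih => simp [bodyAggSafe, ih]

/-- Two interpretations agree on the predicates in `S`. -/
def AgreeOn (S : Set Pred) (I I' : Interp) : Prop := ∀ a : GroundAtom, a.1 ∈ S → (a ∈ I ↔ a ∈ I')

theorem AgreeOn.symm {S : Set Pred} {I I' : Interp} (h : AgreeOn S I I') : AgreeOn S I' I :=
  fun a ha => (h a ha).symm

theorem AgreeOn.mono {S S' : Set Pred} {I I' : Interp} (h : AgreeOn S I I') (hS : S' ⊆ S) :
    AgreeOn S' I I' := fun a ha => h a (hS ha)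

theorem AgreeOn.refl (S : Set Pred) (I : Interp) : AgreeOn S I I := fun _ _ => Iff.rfl

/-- A variable inside braces that does not come from outside is quantified, so neither its value nor
the part of `G` foreign to the element matters. This lets an element move to a rule with other
global variables. -/
theorem Elt.holds_congr (e : Elt) : ∀ {I I' : Interp} {G G' : Finset Var} {s s' : Subst},
    AgreeOn e.preds I I' → (∀ x ∈ e.vars, x ∈ G ↔ x ∈ G') → (∀ x ∈ e.outerVars, s x = s' x) →
    (∀ x ∈ e.vars, x ∈ G → s x = s' x) → (e.Holds I G s ↔ e.Holds I' G' s') := by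
  induction e using Elt.induction with
  | pos a =>
    intro I I' G G' s s' hI _ hs _
    rw [Elt.Holds, Elt.Holds, Atom.subst_congr hs, hI]
    simp [Elt.preds, Atom.subst]
  | neg a =>
    intro I I' G G' s s' hI _ hs _
    rw [Elt.Holds, Elt.Holds, Atom.subst_congr hs, hI]
    simp [Elt.preds, Atom.subst]
  | arith l e =>
    intro I I' G G' s s' _ _ hs _
    simp only [Elt.outerVars, Finset.mem_union] at hs
    rw [Elt.Holds, Elt.Holds, Term.subst_congr fun x hx => hs x (.inl hx),
      Expr.eval_congr fun x hx => hs x (.inr hx)]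
  | agg t cmp f tup body ih =>
    have key : ∀ {I I' : Interp} {G G' : Finset Var} {s s' : Subst},
        AgreeOn (Elt.agg t cmp f tup body).preds I I' →
        (∀ x ∈ (Elt.agg t cmp f tup body).vars, x ∈ G ↔ x ∈ G') →
        (∀ x ∈ (Elt.agg t cmp f tup body).vars, x ∈ G → s x = s' x) →
        {c | ∃ s₁ : Subst, (∀ x ∈ G, s₁ x = s x) ∧
          bodyHolds I (G ∪ aggScope tup body) s₁ body ∧ c = tup.map (Term.subst s₁)} ⊆
        {c | ∃ s₁ : Subst, (∀ x ∈ G', s₁ x = s' x) ∧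
          bodyHolds I' (G' ∪ aggScope tup body) s₁ body ∧ c = tup.map (Term.subst s₁)} := by
      rintro I I' G G' s s' hI hG hs _ ⟨s₁, hs₁, hb, rfl⟩
      have hvars {e : Elt} (he : e ∈ body) {x : Var} (hx : x ∈ e.vars) :
          x ∈ (Elt.agg t cmp f tup body).vars := by
        simp only [Elt.vars, Finset.mem_union]
        exact .inr (mem_bodyVars.2 ⟨e, he, hx⟩)
      -- Off the variables of the aggregate the witness has to follow `s'`, since `G'` may contain
      -- foreign variables on which `s₁` is unrelated to `s'`.
      refine ⟨fun x => if x ∈ (Elt.agg t cmp f tup body).vars then s₁ x else s' x, ?_, ?_, ?_⟩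
      · intro x hx
        dsimp only
        by_cases hv : x ∈ (Elt.agg t cmp f tup body).vars
        · have hx' := (hG x hv).2 hx
          rw [if_pos hv, hs₁ x hx', hs x hv hx']
        · rw [if_neg hv]
      · rw [bodyHolds_iff] at hb ⊢
        intro e he
        refine (ih e he ?_ ?_ ?_ ?_).1 (hb e he)
        · refine hI.mono fun p hp => ?_
          simp only [Elt.preds]
          exact mem_bodyPreds.2 ⟨e, he, hp⟩
        · intro x hx
          simp only [Finset.mem_union, hG x (hvars he hx)]
        · intro x hx
          rw [if_pos (hvars he (e.outerVars_subset hx))]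
        · intro x hx _
          rw [if_pos (hvars he hx)]
      · refine map_subst_congr fun x hx => (if_pos ?_).symm
        simp only [Elt.vars, Finset.mem_union]
        exact .inl (.inr hx)
    intro I I' G G' s s' hI hG ho hs
    rw [Elt.Holds, Elt.Holds, Set.Subset.antisymm (key hI hG hs)
      (key hI.symm (fun x hx => (hG x hx).symm) fun x hx hx' => (hs x hx ((hG x hx).2 hx')).symm),
      Term.subst_congr (t := t) fun x hx => ho x (by simpa only [Elt.outerVars] using hx)]

/-- The truth of a body element in the reduct: positive literals are evaluated in `J` and everything
else in `I`. -/
def Elt.HoldsRed (I J : Interp) (G : Finset Var) (s : Subst) : Elt → Prop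
  | .pos a => a.subst s ∈ J
  | e => e.Holds I G s

theorem Elt.holdsRed_self {I : Interp} {G : Finset Var} {s : Subst} {e : Elt} :
    e.HoldsRed I I G s ↔ e.Holds I G s := by
  cases e <;> simp [Elt.HoldsRed, Elt.Holds]

theorem Elt.holdsRed_of_not_isPos {I J : Interp} {G : Finset Var} {s : Subst} {e : Elt}
    (h : ¬ e.IsPos) : e.HoldsRed I J G s ↔ e.Holds I G s := by
  cases e <;> simp_all [Elt.HoldsRed, Elt.IsPos]

theorem Elt.HoldsRed.mono {I J J' : Interp} {G : Finset Var} {s : Subst} {e : Elt} (hJ : J ⊆ J')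
    (h : e.HoldsRed I J G s) : e.HoldsRed I J' G s := by
  cases e with
  | pos a => exact hJ h
  | _ => exact h

theorem Elt.holdsRed_congr {e : Elt} {I I' J J' : Interp} {G G' : Finset Var} {s s' : Subst}
    (hI : AgreeOn e.preds I I') (hJ : AgreeOn e.preds J J') (hG : ∀ x ∈ e.vars, x ∈ G ↔ x ∈ G')
    (ho : ∀ x ∈ e.outerVars, s x = s' x) (hs : ∀ x ∈ e.vars, x ∈ G → s x = s' x) :
    e.HoldsRed I J G s ↔ e.HoldsRed I' J' G' s' := by
  by_cases hp : e.IsPos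
  · cases e with
    | pos a => exact Elt.holdsRed_self.trans ((Elt.holds_congr _ hJ hG ho hs).trans
        Elt.holdsRed_self.symm)
    | _ => exact hp.elim
  · rw [holdsRed_of_not_isPos hp, holdsRed_of_not_isPos hp, Elt.holds_congr e hI hG ho hs]

/-! ### Answer sets of programs with non-recursive aggregates -/

/-- The instance of the rule under `s` belongs to the reduct with respect to `I`, where aggregates
are evaluated in `I` only, and its positive body is true in `J`. -/
def Rule.Fires (r : Rule) (I J : Interp) (s : Subst) : Prop :=
  ∀ e ∈ r.body, e.HoldsRed I J r.globals s

/-- `J` is a model of the reduct with respect to `I` in which aggregates are evaluated in `I`. -/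
def Program.Closed (P : Program) (I J : Interp) : Prop :=
  ∀ r ∈ P.rules, ∀ s : Subst, r.Fires I J s → ∃ h ∈ r.head, h.subst s ∈ J

theorem Program.model_iff {P : Program} {I : Interp} : P.Model I ↔ P.Closed I I := by
  simp only [Program.Model, Program.Closed, Rule.Fires, Elt.holdsRed_self, bodyHolds_iff]

/-- Testing aggregates in `J` in addition only removes instances, so `Closed` is the stronger
condition. -/
theorem Program.Closed.reductModel {P : Program} {I J : Interp} (h : P.Closed I J) :
    P.ReductModel I J := by
  intro r hr s h1 h2
  refine h r hr s fun e he => ?_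
  by_cases hp : e.IsPos
  · cases e with
    | pos a => exact h2 _ he (by simp [Elt.IsNeg])
    | _ => exact hp.elim
  · exact (Elt.holdsRed_of_not_isPos hp).2 (h1 e he hp)

/-- Let `l` be the lowest level of an atom of `I \ J`, and let `K` be `J` with all atoms of `I`
above `l`. A rule that fires in `K` fires in `I` and has a true head atom there. If this atom is
above `l`, it is in `K`. Otherwise the positive body has level at most `l`, so it is true in `J`,
and the aggregates only see levels below `l`, where `I` and `J` coincide; thus the reduct model `J`
supplies a head atom. -/
theorem Program.NonrecursiveAggregates.exists_closed {P : Program} (hP : P.NonrecursiveAggregates)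
    {I J : Interp} (hI : P.Closed I I) (hJ : J ⊂ I) (h : P.ReductModel I J) :
    ∃ K, K ⊂ I ∧ P.Closed I K := by
  obtain ⟨level, hl⟩ := hP
  have hne : ∃ l, ∃ a ∈ I, a ∉ J ∧ level a.1 = l := by
    obtain ⟨a, ha, ha'⟩ := Set.exists_of_ssubset hJ
    exact ⟨_, a, ha, ha', rfl⟩
  classical
  obtain ⟨b, hb, hb', hbl⟩ := Nat.find_spec hne
  have hmin : ∀ a ∈ I, level a.1 < Nat.find hne → a ∈ J := by
    intro a ha hlt
    by_contra haJ
    exact Nat.find_min hne hlt ⟨a, ha, haJ, rfl⟩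
  set l := Nat.find hne
  refine ⟨J ∪ {a ∈ I | l < level a.1}, ⟨?_, ?_⟩, ?_⟩
  · exact Set.union_subset hJ.1 fun a ha => ha.1
  · intro hsub
    rcases hsub hb with h1 | h1
    · exact hb' h1
    · exact absurd h1.2 (by omega)
  · intro r hr s hf
    have hfI : r.Fires I I s := fun e he =>
      (hf e he).mono (Set.union_subset hJ.1 fun a ha => ha.1)
    obtain ⟨a, ha, haI⟩ := hI r hr s hfI
    by_cases hal : l < level a.pred
    · exact ⟨a, ha, .inr ⟨haI, hal⟩⟩
    · have hJr : ∃ h ∈ r.head, h.subst s ∈ J := by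
        refine h r hr s (fun e he hp => (Elt.holdsRed_of_not_isPos hp).1 (hf e he)) ?_
        intro e he hneg
        cases e with
        | pos c =>
          rcases hf _ he with h1 | h1
          · exact h1
          · have := (hl r hr a ha).1 c he
            have h2 := h1.2
            simp only [Atom.subst] at h2
            omega
        | neg c => exact (hneg trivial).elim
        | arith t e => exact hf _ he
        | agg t cmp f tup body =>
          refine (Elt.holds_congr _ ?_ (fun _ _ => Iff.rfl) (fun _ _ => rfl) fun _ _ _ => rfl).1
            (hf _ he)
          intro c hc
          have hlt := (hl r hr a ha).2 c.1 ⟨t, cmp, f, tup, body, he, by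
            simpa [Elt.preds] using hc⟩
          exact ⟨fun hcI => hmin c hcI (by omega), fun hcJ => hJ.1 hcJ⟩
      obtain ⟨c, hc, hcJ⟩ := hJr
      exact ⟨c, hc, .inl hcJ⟩

theorem Program.NonrecursiveAggregates.answerSet_iff {P : Program} (hP : P.NonrecursiveAggregates)
    {I : Interp} : P.AnswerSet I ↔
      (∀ a ∈ I, a.1 ∈ P.preds) ∧ P.Closed I I ∧ ∀ J ⊆ I, P.Closed I J → J = I := by
  rw [Program.AnswerSet, Program.model_iff]
  refine and_congr_right fun _ => and_congr_right fun hI => ⟨fun h J hJ hc => ?_, fun h J hJ hr => ?_⟩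
  · by_contra hne
    exact h J (hJ.ssubset_of_ne hne) hc.reductModel
  · obtain ⟨K, hK, hc⟩ := hP.exists_closed hI hJ hr
    exact hK.ne (h K hK.1 hc)

/-! ### Extension of a program by definitions of fresh predicates -/

/-- The atoms derivable from `J` with the definite rules `D`, where everything but positive literals
is evaluated in `I`. -/
inductive Derivable (D : List Rule) (I J : Interp) : GroundAtom → Prop
  | base {a : GroundAtom} : a ∈ J → Derivable D I J a
  | step {r : Rule} {h : Atom} {s : Subst} : r ∈ D → r.head = [h] →
      (∀ e ∈ r.body, ¬ e.IsPos → e.Holds I r.globals s) →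
      (∀ a : Atom, Elt.pos a ∈ r.body → Derivable D I J (a.subst s)) → Derivable D I J (h.subst s)

/-- The closure of `J` under the definite rules `D`. -/
def closure (D : List Rule) (I J : Interp) : Interp := {a | Derivable D I J a}

theorem subset_closure {D : List Rule} {I J : Interp} : J ⊆ closure D I J := fun _ => .base

theorem Rule.fires_iff {r : Rule} {I J : Interp} {s : Subst} : r.Fires I J s ↔
    (∀ e ∈ r.body, ¬ e.IsPos → e.Holds I r.globals s) ∧
      ∀ a : Atom, Elt.pos a ∈ r.body → a.subst s ∈ J := by
  constructor
  · exact fun h => ⟨fun e he hp => (Elt.holdsRed_of_not_isPos hp).1 (h e he), fun a ha => h _ ha⟩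
  · rintro ⟨h1, h2⟩ e he
    by_cases hp : e.IsPos
    · cases e with
      | pos a => exact h2 a he
      | _ => exact hp.elim
    · exact (Elt.holdsRed_of_not_isPos hp).2 (h1 e he hp)

theorem closure_step {D : List Rule} {I J : Interp} {r : Rule} {h : Atom} {s : Subst} (hr : r ∈ D)
    (hh : r.head = [h]) (hf : r.Fires I (closure D I J) s) : h.subst s ∈ closure D I J := by
  rw [Rule.fires_iff] at hf
  exact Derivable.step hr hh hf.1 hf.2

theorem closure_inv {D : List Rule} {I J : Interp} {a : GroundAtom} (ha : a ∈ closure D I J) :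
    a ∈ J ∨ ∃ r ∈ D, ∃ h s, r.head = [h] ∧ h.subst s = a ∧ r.Fires I (closure D I J) s := by
  cases ha with
  | base h => exact .inl h
  | step hr hh h1 h2 => exact .inr ⟨_, hr, _, _, hh, rfl, Rule.fires_iff.2 ⟨h1, h2⟩⟩

/-- The closure is the least set closed under `D`. The tests may be evaluated in another
interpretation because those of `D` take place in `I` here but in an answer set of the extended
program there. -/
theorem closure_subset {D : List Rule} {I I' J K : Interp} (hJ : J ⊆ K)
    (hI : ∀ r ∈ D, ∀ e ∈ r.body, ¬ e.IsPos → AgreeOn e.preds I I')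
    (hK : ∀ r ∈ D, ∀ s, r.Fires I' K s → ∃ h ∈ r.head, h.subst s ∈ K) : closure D I J ⊆ K := by
  intro a ha
  induction ha with
  | base h => exact hJ h
  | step hr hh h1 _ ih =>
    obtain ⟨h', hh', hs⟩ := hK _ hr _ (Rule.fires_iff.2 ⟨fun e he hp =>
      (Elt.holds_congr e (hI _ hr e he hp) (fun _ _ => Iff.rfl) (fun _ _ => rfl)
        fun _ _ _ => rfl).1 (h1 e he hp), ih⟩)
    rw [hh, List.mem_singleton] at hh'
    exact hh' ▸ hs

theorem closure_mono {D : List Rule} {I J J' : Interp} (h : J ⊆ J') :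
    closure D I J ⊆ closure D I J' := by
  intro a ha
  induction ha with
  | base h' => exact .base (h h')
  | step hr hh h1 _ ih => exact Derivable.step hr hh h1 ih

theorem mem_closure_iff {D : List Rule} {I J : Interp} {S : Finset Pred}
    (hD : ∀ r ∈ D, ∀ h ∈ r.head, h.pred ∉ S) {a : GroundAtom} (ha : a.1 ∈ S) :
    a ∈ closure D I J ↔ a ∈ J := by
  refine ⟨fun h => ?_, fun h => .base h⟩
  rcases closure_inv h with h | ⟨r, hr, b, s, hh, rfl, -⟩
  · exact h
  · exact (hD r hr b (by simp [hh]) ha).elim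

theorem restrict_subset {S : Finset Pred} {I : Interp} : restrict S I ⊆ I := fun _ h => h.1

theorem agreeOn_restrict {S : Finset Pred} {I : Interp} : AgreeOn S (restrict S I) I :=
  fun _ ha => ⟨fun h => h.1, fun h => ⟨h, ha⟩⟩

theorem restrict_restrict {S S' : Finset Pred} (h : S ⊆ S') (I : Interp) :
    restrict S (restrict S' I) = restrict S I := by
  ext a
  exact ⟨fun ha => ⟨ha.1.1, ha.2⟩, fun ha => ⟨⟨ha.1, h ha.2⟩, ha.2⟩⟩

theorem Rule.fires_congr {r : Rule} {I I' J J' : Interp} {s : Subst} (hI : AgreeOn r.preds I I')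
    (hJ : AgreeOn r.preds J J') : r.Fires I J s ↔ r.Fires I' J' s := by
  refine forall₂_congr fun e he => ?_
  have hsub : (e.preds : Set Pred) ⊆ r.preds := fun p hp =>
    Finset.mem_union_right _ (mem_bodyPreds.2 ⟨e, he, hp⟩)
  exact Elt.holdsRed_congr (hI.mono hsub) (hJ.mono hsub) (fun _ _ => Iff.rfl) (fun _ _ => rfl)
    fun _ _ _ => rfl

theorem Program.rule_preds_subset {P : Program} {r : Rule} (hr : r ∈ P.rules) :
    r.preds ⊆ P.preds := fun _ hp => Program.mem_preds.2 (.inl ⟨r, hr, hp⟩)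

theorem Rule.head_preds {r : Rule} {h : Atom} (hh : h ∈ r.head) : h.pred ∈ r.preds :=
  Finset.mem_union_left _ (mem_atomsPreds.2 ⟨h, hh, rfl⟩)

/-- `Q` results from `P` by adding definite rules `D` that define fresh predicates, and by replacing
the rules of `P` with rules that are equivalent in the presence of `D`. -/
structure DefinitionalExtension (P Q : Program) (D : List Rule) : Prop where
  preds_subset : P.preds ⊆ Q.preds
  mem : ∀ r ∈ D, r ∈ Q.rules
  head : ∀ r ∈ D, ∃ h : Atom, r.head = [h] ∧ h.pred ∉ P.preds
  tests : ∀ r ∈ D, ∀ e ∈ r.body, ¬ e.IsPos → e.preds ⊆ P.preds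
  forward : ∀ r ∈ P.rules, ∃ r' ∈ Q.rules, ∀ I J s, (∀ a ∈ I, a.1 ∈ P.preds) → J ⊆ I →
    r.Fires I J s → ∃ s', r'.Fires (closure D I I) (closure D I J) s' ∧
      r'.head.map (Atom.subst s') = r.head.map (Atom.subst s)
  backward : ∀ r' ∈ Q.rules, r' ∈ D ∨ ∃ r ∈ P.rules, r'.head = r.head ∧
    ∀ I J s, (∀ a ∈ I, a.1 ∈ P.preds) → J ⊆ I →
    r'.Fires (closure D I I) (closure D I J) s → ∃ s', r.Fires I J s' ∧
      r.head.map (Atom.subst s') = r'.head.map (Atom.subst s)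

namespace DefinitionalExtension

variable {P Q : Program} {D : List Rule}

theorem exists_head_of_map_eq {r r' : List Atom} {s s' : Subst} {J : Interp}
    (h : r.map (Atom.subst s) = r'.map (Atom.subst s')) (hr : ∃ a ∈ r, a.subst s ∈ J) :
    ∃ a ∈ r', a.subst s' ∈ J := by
  obtain ⟨a, ha, haJ⟩ := hr
  have : a.subst s ∈ r'.map (Atom.subst s') := h ▸ List.mem_map_of_mem ha
  obtain ⟨b, hb, hba⟩ := List.mem_map.1 this
  exact ⟨b, hb, hba ▸ haJ⟩

theorem head_fresh (h : DefinitionalExtension P Q D) :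
    ∀ r ∈ D, ∀ a ∈ r.head, a.pred ∉ P.preds := by
  intro r hr a ha
  obtain ⟨b, hb, hb'⟩ := h.head r hr
  rw [hb, List.mem_singleton] at ha
  exact ha ▸ hb'

theorem agreeOn_closure (h : DefinitionalExtension P Q D) (I J : Interp) :
    AgreeOn P.preds J (closure D I J) := fun _ ha => (mem_closure_iff h.head_fresh ha).symm

theorem restrict_closure (h : DefinitionalExtension P Q D) {I J : Interp}
    (hJ : ∀ a ∈ J, a.1 ∈ P.preds) : restrict P.preds (closure D I J) = J := by
  ext a
  constructor
  · exact fun ha => (h.agreeOn_closure I J a ha.2).2 ha.1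
  · exact fun ha => ⟨.base ha, hJ a ha⟩

/-- Replacing the interpretation of the tests by the closure has no influence on the definitions. -/
theorem fires_closure_iff (h : DefinitionalExtension P Q D) {r : Rule} (hr : r ∈ D)
    {I I' J : Interp} {s : Subst} (hI : AgreeOn P.preds I I') :
    r.Fires I J s ↔ r.Fires I' J s := by
  simp only [Rule.fires_iff]
  refine and_congr_left fun _ => forall₃_congr fun e he hp => ?_
  exact Elt.holds_congr e (hI.mono (by exact_mod_cast h.tests r hr e he hp)) (fun _ _ => Iff.rfl)
    (fun _ _ => rfl) fun _ _ _ => rfl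

/-- An instance that fires in the restriction has a counterpart that fires in the closure of the
restriction, hence in `J'`, as positive literals are monotone. The head atom found there is over old
predicates. -/
theorem closed_restrict (h : DefinitionalExtension P Q D) {I J' : Interp}
    (hI : ∀ a ∈ I, a.1 ∈ P.preds) (hsub : restrict P.preds J' ⊆ I)
    (hJ : closure D I (restrict P.preds J') ⊆ J') (hc : Q.Closed (closure D I I) J') :
    P.Closed I (restrict P.preds J') := by
  intro r hr s hf
  obtain ⟨r', hr', H⟩ := h.forward r hr
  obtain ⟨s', hf', heq⟩ := H I _ s hI hsub hf
  obtain ⟨a, ha, haJ⟩ := exists_head_of_map_eq heq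
    (hc r' hr' s' fun e he => (hf' e he).mono hJ)
  exact ⟨a, ha, haJ, Program.rule_preds_subset hr (Rule.head_preds ha)⟩

theorem closed_closure (h : DefinitionalExtension P Q D) {I J : Interp}
    (hI : ∀ a ∈ I, a.1 ∈ P.preds) (hsub : J ⊆ I) (hc : P.Closed I J) :
    Q.Closed (closure D I I) (closure D I J) := by
  intro r' hr' s hf
  rcases h.backward r' hr' with hD | ⟨r, hr, -, H⟩
  · obtain ⟨a, ha, -⟩ := h.head r' hD
    exact ⟨a, by simp [ha], closure_step hD ha
      ((h.fires_closure_iff hD (h.agreeOn_closure I I)).2 hf)⟩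
  · obtain ⟨s', hf', heq⟩ := H I J s hI hsub hf
    obtain ⟨a, ha, haJ⟩ := exists_head_of_map_eq heq (hc r hr s' hf')
    exact ⟨a, ha, .base haJ⟩

theorem closure_subset_of_closed (h : DefinitionalExtension P Q D) {I I' J' : Interp}
    (hI : AgreeOn P.preds I I') (hc : Q.Closed I' J') :
    closure D I (restrict P.preds J') ⊆ J' :=
  closure_subset restrict_subset
    (fun r hr e he hp => hI.mono (by exact_mod_cast h.tests r hr e he hp))
    fun r hr s hf => hc r (h.mem r hr) s hf

/-- A closed `J'` inside the closure restricts to a closed subset of `I`, which is `I` by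
minimality. Then `J'` contains the closure, the least closed set over `I`. -/
theorem answerSet_closure (h : DefinitionalExtension P Q D) (hP : P.NonrecursiveAggregates)
    (hQ : Q.NonrecursiveAggregates) {I : Interp} (hI : P.AnswerSet I) :
    Q.AnswerSet (closure D I I) := by
  rw [hP.answerSet_iff] at hI
  rw [hQ.answerSet_iff]
  obtain ⟨h1, h2, h3⟩ := hI
  refine ⟨fun a ha => ?_, h.closed_closure h1 subset_rfl h2, fun J' hJ' hc => ?_⟩
  · rcases closure_inv ha with ha | ⟨r, hr, a, s, hh, rfl, -⟩
    · exact h.preds_subset (h1 a ha)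
    · exact Program.rule_preds_subset (h.mem r hr) (Rule.head_preds (h := a) (by simp [hh]))
  · have hsub : restrict P.preds J' ⊆ I := fun a ha =>
      (h.agreeOn_closure I I a ha.2).2 (hJ' ha.1)
    have hcl := h.closure_subset_of_closed (h.agreeOn_closure I I) hc
    have heq := h3 _ hsub (h.closed_restrict h1 hsub hcl hc)
    rw [heq] at hcl
    exact hJ'.antisymm hcl

/-- The closure of the restriction lies inside the answer set and is itself closed, so minimality
forces equality: a fresh atom is true only if it is derivable. -/
theorem eq_closure (h : DefinitionalExtension P Q D) (hQ : Q.NonrecursiveAggregates) {I' : Interp}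
    (hI' : Q.AnswerSet I') :
    closure D (restrict P.preds I') (restrict P.preds I') = I' := by
  rw [hQ.answerSet_iff] at hI'
  obtain ⟨-, h2, h3⟩ := hI'
  have hcl := h.closure_subset_of_closed agreeOn_restrict h2
  refine h3 _ hcl fun r' hr' s hf => ?_
  rcases h.backward r' hr' with hD | ⟨r, hr, hh, -⟩
  · obtain ⟨a, ha, -⟩ := h.head r' hD
    exact ⟨a, by simp [ha], closure_step hD ha ((h.fires_closure_iff hD agreeOn_restrict).2 hf)⟩
  -- A replaced rule keeps its head, whose predicates are old. So the head atom that is true in `I'`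
  -- survives the restriction.
  · obtain ⟨a, ha, haI⟩ := h2 r' hr' s fun e he => (hf e he).mono hcl
    exact ⟨a, ha, .base ⟨haI, Program.rule_preds_subset hr (Rule.head_preds (hh ▸ ha))⟩⟩

theorem answerSet_restrict (h : DefinitionalExtension P Q D) (hP : P.NonrecursiveAggregates)
    (hQ : Q.NonrecursiveAggregates) {I' : Interp} (hI' : Q.AnswerSet I') :
    P.AnswerSet (restrict P.preds I') := by
  have heq := h.eq_closure hQ hI'
  rw [hQ.answerSet_iff] at hI'
  rw [hP.answerSet_iff]
  obtain ⟨-, h2, h3⟩ := hI'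
  have h1 : ∀ a ∈ restrict P.preds I', a.1 ∈ P.preds := fun a ha => ha.2
  refine ⟨h1, ?_, fun J hJ hc => ?_⟩
  · refine h.closed_restrict h1 subset_rfl heq.subset ?_
    rwa [heq]
  · have := h.closed_closure h1 hJ hc
    rw [heq] at this
    have hs : closure D (restrict P.preds I') J ⊆ I' := (closure_mono hJ).trans heq.subset
    rw [← h3 _ hs this, h.restrict_closure fun a ha => (hJ ha).2]

theorem bijOn (h : DefinitionalExtension P Q D) (hP : P.NonrecursiveAggregates)
    (hQ : Q.NonrecursiveAggregates) :
    Set.BijOn (restrict P.preds) {I | Q.AnswerSet I} {I | P.AnswerSet I} := by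
  refine ⟨fun I hI => h.answerSet_restrict hP hQ hI, fun I hI J hJ heq => ?_, fun I hI => ?_⟩
  · rw [← h.eq_closure hQ hI, ← h.eq_closure hQ hJ, heq]
  · exact ⟨_, h.answerSet_closure hP hQ hI, h.restrict_closure hI.1⟩

end DefinitionalExtension

/-! ### Refinement of programs -/

theorem Program.costTuples_congr {P : Program} {I I' : Interp} (h : AgreeOn P.preds I I') :
    P.costTuples I = P.costTuples I' := by
  ext c
  simp only [Program.costTuples, Set.mem_ofPred_eq, bodyHolds_iff]
  refine exists_congr fun w => and_congr_right fun hw => exists_congr fun s =>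
    and_congr_left fun _ => forall₂_congr fun e he => ?_
  refine Elt.holds_congr e (h.mono fun p hp => ?_) (fun _ _ => Iff.rfl) (fun _ _ => rfl)
    fun _ _ _ => rfl
  exact Program.mem_preds.2 (.inr ⟨w, hw, mem_bodyPreds.2 ⟨e, he, hp⟩⟩)

theorem Program.costTuples_eq_of_weak_eq {P Q : Program} (h : Q.weak = P.weak) (I : Interp) :
    Q.costTuples I = P.costTuples (restrict P.preds I) := by
  rw [Program.costTuples_congr agreeOn_restrict]
  simp only [Program.costTuples, h]

/-- The program `Q` can take the place of `P`. -/
structure Program.Refines (Q P : Program) : Prop where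
  preds_subset : P.preds ⊆ Q.preds
  safe : Q.Safe
  nonrecursive : Q.NonrecursiveAggregates
  bijOn : Set.BijOn (restrict P.preds) {I | Q.AnswerSet I} {I | P.AnswerSet I}
  weight : ∀ I, Q.AnswerSet I → Q.weight I = P.weight (restrict P.preds I)

theorem Program.Refines.refl {P : Program} (h1 : P.Safe) (h2 : P.NonrecursiveAggregates) :
    P.Refines P := by
  have h : ∀ I, P.AnswerSet I → restrict P.preds I = I := fun I hI =>
    Set.ext fun a => ⟨fun ha => ha.1, fun ha => ⟨ha, hI.1 a ha⟩⟩
  refine ⟨subset_rfl, h1, h2, (Set.bijOn_id _).congr fun I hI => (h I hI).symm, fun I hI => ?_⟩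
  rw [h I hI]

theorem Program.Refines.trans {P Q R : Program} (h : R.Refines Q) (h' : Q.Refines P) :
    R.Refines P := by
  have heq : ∀ I, restrict P.preds (restrict Q.preds I) = restrict P.preds I :=
    restrict_restrict h'.preds_subset
  refine ⟨h'.preds_subset.trans h.preds_subset, h.safe, h.nonrecursive,
    (h'.bijOn.comp h.bijOn).congr fun I _ => heq I, fun I hI => ?_⟩
  rw [h.weight I hI, h'.weight _ (h.bijOn.mapsTo hI), heq]

theorem Program.Refines.bijOn_optimal {P Q : Program} (h : Q.Refines P) :
    Set.BijOn (restrict P.preds) {I | Q.OptimalAnswerSet I} {I | P.OptimalAnswerSet I} := by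
  refine ⟨fun I hI => ?_, h.bijOn.injOn.mono fun I hI => hI.1, fun I hI => ?_⟩
  · obtain ⟨hI, z, hz, hmin⟩ := hI
    refine ⟨h.bijOn.mapsTo hI, z, h.weight I hI ▸ hz, fun J hJ z' hz' => ?_⟩
    obtain ⟨J', hJ', rfl⟩ := h.bijOn.surjOn hJ
    exact hmin J' hJ' z' (by rw [h.weight J' hJ', hz'])
  · obtain ⟨hI, z, hz, hmin⟩ := hI
    obtain ⟨I', hI', rfl⟩ := h.bijOn.surjOn hI
    refine ⟨I', ⟨hI', z, by rw [h.weight I' hI', hz], fun J hJ z' hz' => ?_⟩, rfl⟩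
    exact hmin _ (h.bijOn.mapsTo hJ) z' (by rw [← h.weight J hJ, hz'])

theorem DefinitionalExtension.refines {P Q : Program} {D : List Rule}
    (h : DefinitionalExtension P Q D) (hP : P.NonrecursiveAggregates)
    (hQ : Q.NonrecursiveAggregates) (hs : Q.Safe) (hw : Q.weak = P.weak) : Q.Refines P :=
  ⟨h.preds_subset, hs, hQ, h.bijOn hP hQ, fun I _ => by
    rw [Program.weight, Program.weight, Program.costTuples_eq_of_weak_eq hw]⟩

/-! ### Safety -/

theorem Bound.mono {B B' : List Elt} {K K' : Finset Var} (hB : B ⊆ B') (hK : K ⊆ K') {x : Var}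
    (h : Bound B K x) : Bound B' K' x := by
  induction h with
  | known hx => exact .known (hK hx)
  | pos ha hx => exact .pos (hB ha) hx
  | arith he _ ih => exact .arith (hB he) ih

/-- Right-hand sides of expressions in `B` consist of outer variables of `B`, so a derivation that
starts in `V` never leaves it. -/
theorem Bound.congr_known {B : List Elt} {K K' V : Finset Var} (hB : outerVars B ⊆ V)
    (hK : ∀ x ∈ V, x ∈ K → x ∈ K') {x : Var} (h : Bound B K x) (hx : x ∈ V) : Bound B K' x := by
  induction h with
  | known h => exact .known (hK _ hx h)
  | pos ha h => exact .pos ha h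
  | arith he _ ih =>
    refine .arith he fun y hy => ih y hy (hB (mem_outerVars.2 ⟨_, he, ?_⟩))
    simp [Elt.outerVars, hy]

theorem Elt.AggSafe.mono (e : Elt) : ∀ {G G' : Finset Var}, (∀ x ∈ e.vars, x ∈ G → x ∈ G') →
    e.AggSafe G → e.AggSafe G' := by
  induction e using Elt.induction with
  | pos a => intros; trivial
  | neg a => intros; trivial
  | arith l e => intros; trivial
  | agg t cmp f tup body ih =>
    intro G G' hG h
    rw [Elt.AggSafe, bodyAggSafe_iff] at h ⊢
    have hb : ∀ x ∈ bodyVars body, x ∈ (Elt.agg t cmp f tup body).vars := fun x hx => by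
      simp [Elt.vars, hx]
    refine ⟨fun x hx => (h.1 x hx).congr_known (V := (Elt.agg t cmp f tup body).vars)
      (fun y hy => hb y (outerVars_subset_bodyVars _ hy)) hG (aggScope_subset t cmp f tup body hx),
      fun e he => ih e he (fun x hx hxG => ?_) (h.2 e he)⟩
    rw [Finset.mem_union] at hxG ⊢
    exact hxG.imp_left (hG x (hb x (mem_bodyVars.2 ⟨e, he, hx⟩)))

/-- Positive literals and arithmetic expressions. -/
def Elt.IsSimple : Elt → Prop
  | .pos _ => True
  | .arith _ _ => True
  | _ => False

theorem Elt.IsSimple.aggSafe {e : Elt} (h : e.IsSimple) (G : Finset Var) : e.AggSafe G := by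
  cases e <;> trivial

theorem Elt.IsSimple.holds_congr {e : Elt} (h : e.IsSimple) {I : Interp} {G G' : Finset Var}
    {s s' : Subst} (hs : ∀ x ∈ e.outerVars, s x = s' x) : e.Holds I G s ↔ e.Holds I G' s' := by
  have hG : e.Holds I G s ↔ e.Holds I G' s := by
    cases e with
    | pos a => rw [Elt.Holds, Elt.Holds]
    | arith l e => rw [Elt.Holds, Elt.Holds]
    | _ => exact h.elim
  rw [hG]
  refine Elt.holds_congr e (.refl _ _) (fun _ _ => Iff.rfl) hs fun x hx _ => hs x ?_
  cases e with
  | pos a => exact hx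
  | arith l e => exact hx
  | _ => exact h.elim

theorem Elt.IsSimple.holdsRed_congr {e : Elt} (h : e.IsSimple) {I I' J : Interp}
    {G G' : Finset Var} {s : Subst} (hr : e.HoldsRed I J G s) : e.HoldsRed I' J G' s := by
  cases e with
  | pos a => exact hr
  | arith l e =>
    simp only [Elt.HoldsRed, Elt.Holds] at hr ⊢
    exact hr
  | _ => exact h.elim

/-! ### Domain predicates -/

theorem mem_domAtoms {dom : Var → Pred} {X : Finset Var} {e : Elt} :
    e ∈ domAtoms dom X ↔ ∃ x ∈ X, e = .pos ⟨dom x, [.var x]⟩ := by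
  simp [domAtoms, eq_comm]

theorem mem_domRules {dom : Var → Pred} {A : Var → List Elt} {X : Finset Var} {r : Rule} :
    r ∈ domRules dom A X ↔ ∃ x ∈ X, r = ⟨[⟨dom x, [.var x]⟩], A x⟩ := by
  simp [domRules, eq_comm]

theorem outerVars_domAtoms (dom : Var → Pred) (X : Finset Var) :
    outerVars (domAtoms dom X) = X := by
  ext x
  simp only [mem_outerVars, mem_domAtoms]
  constructor
  · rintro ⟨_, ⟨y, hy, rfl⟩, hx⟩
    simp only [Elt.outerVars, Atom.vars, mem_termsVars, List.mem_singleton, exists_eq_left,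
      Term.vars, Finset.mem_singleton] at hx
    exact hx ▸ hy
  · intro hx
    exact ⟨_, ⟨x, hx, rfl⟩, by simp [Elt.outerVars, Atom.vars, mem_termsVars, Term.vars]⟩

theorem GreedySelection.mem {B A : List Elt} {S : Finset Var} (h : GreedySelection B S A) :
    ∀ e ∈ A, e ∈ B ∧ e.IsSimple := by
  induction h with
  | done => simp
  | atom _ ha _ _ ih => simpa using ⟨⟨ha, trivial⟩, ih⟩
  | arith _ _ he _ ih => simpa using ⟨⟨he, trivial⟩, ih⟩

/-- A selected atom binds all its variables. The right-hand side of a selected expression is put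
into `S` and hence bound by later selections. The second half is needed for the safety of domain
rules, whose bodies contain more variables than those asked for. -/
theorem GreedySelection.bound {B A : List Elt} {S : Finset Var} (h : GreedySelection B S A) :
    (∀ x ∈ S, Bound A ∅ x) ∧ ∀ x ∈ outerVars A, Bound A ∅ x := by
  induction h with
  | done => simp [outerVars]
  | @atom S x a A hx ha hxa _ ih =>
    have hmono {y : Var} (hy : Bound A ∅ y) : Bound (.pos a :: A) ∅ y :=
      hy.mono (List.subset_cons_self _ _) subset_rfl
    refine ⟨fun y hy => ?_, fun y hy => ?_⟩
    · by_cases hyx : y = x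
      · exact .pos List.mem_cons_self (hyx ▸ hxa)
      · exact hmono (ih.1 y (by simp [hy, hyx]))
    · rw [← List.singleton_append, outerVars_append, Finset.mem_union] at hy
      rcases hy with hy | hy
      · exact .pos List.mem_cons_self (by simpa [outerVars, Elt.outerVars] using hy)
      · exact hmono (ih.2 y hy)
  | @arith S x e A hx _ he _ ih =>
    have hmono {y : Var} (hy : Bound A ∅ y) : Bound (.arith (.var x) e :: A) ∅ y :=
      hy.mono (List.subset_cons_self _ _) subset_rfl
    have hb : Bound (.arith (.var x) e :: A) ∅ x :=
      .arith List.mem_cons_self fun y hy => hmono (ih.1 y (by simp [hy]))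
    refine ⟨fun y hy => ?_, fun y hy => ?_⟩
    · by_cases hyx : y = x
      · exact hyx ▸ hb
      · exact hmono (ih.1 y (by simp [hy, hyx]))
    · rw [← List.singleton_append, outerVars_append, Finset.mem_union] at hy
      rcases hy with hy | hy
      · simp only [outerVars, Elt.outerVars, Term.vars, List.foldr_cons, List.foldr_nil,
          Finset.union_empty, Finset.mem_union, Finset.mem_singleton] at hy
        rcases hy with hy | hy
        · exact hy ▸ hb
        · exact hmono (ih.1 y (by simp [hy]))
      · exact hmono (ih.2 y hy)

theorem sdiff_singleton_of_notMem {S : Finset Var} {x : Var} (h : x ∉ S) : S \ {x} = S :=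
  Finset.sdiff_eq_self_of_disjoint (by simpa using h)

/-- The set `S` is arbitrary so that the induction hypotheses for the right-hand side of an
expression can be applied one variable after the other, on top of what is already pending. -/
theorem GreedySelection.exists_union_singleton {B : List Elt} {x : Var} (h : Bound B ∅ x) :
    ∀ {S : Finset Var}, (∃ A, GreedySelection B S A) → ∃ A, GreedySelection B (S ∪ {x}) A := by
  induction h with
  | known hx => exact absurd hx (Finset.notMem_empty _)
  | @pos a x ha hx =>
    rintro S ⟨A, hA⟩
    by_cases hS : x ∈ S
    · exact ⟨A, by rwa [Finset.union_eq_left.2 (by simpa using hS)]⟩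
    · refine ⟨_, .atom (by simp) ha hx (A := A) ?_⟩
      rwa [Finset.union_sdiff_right, sdiff_singleton_of_notMem hS]
  | @arith x e he _ ih =>
    rintro S ⟨A, hA⟩
    by_cases hS : x ∈ S
    · exact ⟨A, by rwa [Finset.union_eq_left.2 (by simpa using hS)]⟩
    by_cases hpos : ∃ a : Atom, Elt.pos a ∈ B ∧ x ∈ a.vars
    · obtain ⟨a, ha, hx⟩ := hpos
      refine ⟨_, .atom (by simp) ha hx (A := A) ?_⟩
      rwa [Finset.union_sdiff_right, sdiff_singleton_of_notMem hS]
    · push Not at hpos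
      have hall : ∀ V : Finset Var, V ⊆ e.vars → ∃ A, GreedySelection B (S ∪ V) A := by
        intro V
        induction V using Finset.induction_on with
        | empty => exact fun _ => ⟨A, by simpa using hA⟩
        | insert y V _ ihV =>
          intro hV
          have := ih y (hV (Finset.mem_insert_self _ _))
            (ihV ((Finset.subset_insert _ _).trans hV))
          rwa [Finset.union_assoc, Finset.union_comm V, ← Finset.insert_eq] at this
      obtain ⟨A', hA'⟩ := hall e.vars subset_rfl
      refine ⟨_, .arith (by simp) hpos he (A := A') ?_⟩
      rwa [Finset.union_sdiff_right, sdiff_singleton_of_notMem hS]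

theorem Bound.exists_greedySelection {B : List Elt} {x : Var} (h : Bound B ∅ x) :
    ∃ A, GreedySelection B {x} A := by
  simpa using GreedySelection.exists_union_singleton h ⟨[], .done⟩

theorem GreedySelection.domRule_safe {B A : List Elt} {x : Var} (h : GreedySelection B {x} A)
    (p : Pred) : Rule.Safe ⟨[⟨p, [.var x]⟩], A⟩ := by
  refine ⟨fun y hy => ?_, bodyAggSafe_iff.2 fun e he => (h.mem e he).2.aggSafe _⟩
  simp only [Rule.globals, Finset.mem_union, mem_atomsVars, List.mem_singleton, exists_eq_left,
    Atom.vars, mem_termsVars, Term.vars, Finset.mem_singleton] at hy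
  rcases hy with rfl | hy
  · exact h.bound.1 _ (by simp)
  · exact h.bound.2 y hy

/-- `A` is a part of `B`, so any substitution that makes `B` true makes the domain atom derivable;
therefore domain atoms exclude no solutions. -/
theorem GreedySelection.mem_closure {B A : List Elt} {x : Var} (h : GreedySelection B {x} A)
    {D : List Rule} {p : Pred} (hD : ⟨[⟨p, [.var x]⟩], A⟩ ∈ D) {I J : Interp} {G : Finset Var}
    {s : Subst} (hB : ∀ e ∈ B, e.IsSimple → e.HoldsRed I J G s) :
    Atom.subst s ⟨p, [.var x]⟩ ∈ closure D I J := by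
  refine closure_step hD rfl fun e he => ?_
  obtain ⟨heB, hes⟩ := h.mem e he
  exact (hes.holdsRed_congr (hB e heB hes)).mono subset_closure

theorem Elt.IsSimple.preds_eq_empty {e : Elt} (h : e.IsSimple) (hp : ¬ e.IsPos) :
    e.preds = ∅ := by
  cases e <;> simp_all [Elt.IsSimple, Elt.IsPos, Elt.preds]

theorem Rule.fires_closure_of_preds_subset {D : List Rule} {S : Finset Pred}
    (hD : ∀ r ∈ D, ∀ h ∈ r.head, h.pred ∉ S) {r : Rule} (hr : r.preds ⊆ S) {I J : Interp}
    {s : Subst} : r.Fires (closure D I I) (closure D I J) s ↔ r.Fires I J s :=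
  Rule.fires_congr (fun _ ha => mem_closure_iff hD (hr ha)) fun _ ha => mem_closure_iff hD (hr ha)

/-! ### Stratification -/

/-- The condition that a rule imposes on the levels of the predicates. -/
def Rule.Stratified (level : Pred → ℕ) (r : Rule) : Prop :=
  ∀ h ∈ r.head, (∀ a : Atom, Elt.pos a ∈ r.body → level a.pred ≤ level h.pred) ∧
    ∀ p ∈ aggPreds r.body, level p < level h.pred

theorem aggPreds_subset (B : List Elt) : aggPreds B ⊆ bodyPreds B := by
  rintro p ⟨t, cmp, f, tup, body, h, hp⟩
  exact mem_bodyPreds.2 ⟨_, h, by simpa [Elt.preds] using hp⟩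

theorem pos_pred_mem {B : List Elt} {a : Atom} (h : Elt.pos a ∈ B) : a.pred ∈ bodyPreds B :=
  mem_bodyPreds.2 ⟨_, h, by simp [Elt.preds]⟩

theorem Rule.Stratified.congr {level level' : Pred → ℕ} {r : Rule} (h : r.Stratified level)
    (hl : ∀ p ∈ r.preds, level' p = level p) : r.Stratified level' := by
  intro a ha
  have hB : ∀ p ∈ bodyPreds r.body, level' p = level p := fun p hp =>
    hl p (Finset.mem_union_right _ hp)
  rw [hl _ (Rule.head_preds ha)]
  refine ⟨fun b hb => ?_, fun p hp => ?_⟩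
  · rw [hB _ (pos_pred_mem hb)]
    exact (h a ha).1 b hb
  · rw [hB p (aggPreds_subset _ hp)]
    exact (h a ha).2 p hp

theorem GreedySelection.aggPreds_eq_empty {B A : List Elt} {S : Finset Var}
    (h : GreedySelection B S A) : aggPreds A = ∅ := by
  ext p
  simp only [Set.mem_empty_iff_false, iff_false]
  rintro ⟨t, cmp, f, tup, body, hm, -⟩
  exact (h.mem _ hm).2

theorem exists_fresh (S : Finset Pred) : ∃ N, ∀ n, N ≤ n → n ∉ S :=
  ⟨S.sup id + 1, fun n hn h => by
    have := Finset.le_sup (f := id) h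
    exact absurd (this.trans_lt (Nat.lt_of_succ_le hn)) (lt_irrefl _)⟩

/-! ### Weak constraints -/

theorem WeakConstraint.tempRule_globals (w : WeakConstraint) (temp : Pred) :
    (w.tempRule temp).globals = w.globals := by
  simp [WeakConstraint.tempRule, Rule.globals, WeakConstraint.globals, atomsVars, Atom.vars]

theorem weak_definitionalExtension {l : List Rule} {W₁ W₂ : List WeakConstraint}
    {w : WeakConstraint} {temp : Pred} (h : temp ∉ Program.preds ⟨l, W₁ ++ w :: W₂⟩) :
    DefinitionalExtension ⟨l, W₁ ++ w :: W₂⟩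
      ⟨w.tempRule temp :: l, W₁ ++ w.tempConstraint temp :: W₂⟩ [w.tempRule temp] where
  preds_subset p hp := by
    rw [Program.mem_preds] at hp ⊢
    rcases hp with ⟨r, hr, hp⟩ | ⟨v, hv, hp⟩
    · exact .inl ⟨r, List.mem_cons_of_mem _ hr, hp⟩
    · simp only [List.mem_append, List.mem_cons] at hv
      rcases hv with hv | rfl | hv
      · exact .inr ⟨v, by simp [hv], hp⟩
      · exact .inl ⟨v.tempRule temp, by simp, Finset.mem_union_right _ hp⟩
      · exact .inr ⟨v, by simp [hv], hp⟩
  mem r hr := by simp_all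
  head r hr := by
    rw [List.mem_singleton] at hr
    subst hr
    exact ⟨_, rfl, h⟩
  tests r hr e he _ p hp := by
    rw [List.mem_singleton] at hr
    subst hr
    exact Program.mem_preds.2 (.inr ⟨w, by simp, mem_bodyPreds.2 ⟨e, he, hp⟩⟩)
  forward r hr := by
    refine ⟨r, List.mem_cons_of_mem _ hr, fun I J s _ _ hf => ⟨s, ?_, rfl⟩⟩
    refine (Rule.fires_closure_of_preds_subset ?_
      (Program.rule_preds_subset (P := ⟨l, W₁ ++ w :: W₂⟩) hr)).2 hf
    simpa [WeakConstraint.tempRule] using h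
  backward r hr := by
    rcases List.mem_cons.1 hr with hr | hr
    · exact .inl (by simp [hr])
    refine .inr ⟨r, hr, rfl, fun I J s _ _ hf => ⟨s, ?_, rfl⟩⟩
    refine (Rule.fires_closure_of_preds_subset ?_
      (Program.rule_preds_subset (P := ⟨l, W₁ ++ w :: W₂⟩) hr)).1 hf
    simpa [WeakConstraint.tempRule] using h

theorem weak_nonrecursive {l : List Rule} {W₁ W₂ W' : List WeakConstraint}
    {w : WeakConstraint} {temp : Pred} (h : temp ∉ Program.preds ⟨l, W₁ ++ w :: W₂⟩)
    (hP : Program.NonrecursiveAggregates ⟨l, W₁ ++ w :: W₂⟩) :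
    Program.NonrecursiveAggregates ⟨w.tempRule temp :: l, W'⟩ := by
  obtain ⟨level, hl⟩ := hP
  set S := Program.preds ⟨l, W₁ ++ w :: W₂⟩ with hS
  have hne : ∀ p ∈ S, Function.update level temp (S.sup level + 1) p = level p := fun p hp =>
    Function.update_of_ne (fun heq => by subst heq; exact h hp) _ _
  -- No rule has `temp` in its body, so it may be put above all other predicates.
  refine ⟨Function.update level temp (S.sup level + 1), fun r hr => ?_⟩
  rcases List.mem_cons.1 hr with rfl | hr
  · intro a ha
    simp only [WeakConstraint.tempRule, List.mem_singleton] at ha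
    subst ha
    have hw : ∀ p ∈ bodyPreds w.body, Function.update level temp (S.sup level + 1) p <
        Function.update level temp (S.sup level + 1) temp := fun p hp => by
      have hpS : p ∈ S := Program.mem_preds.2 (.inr ⟨w, by simp, hp⟩)
      rw [hne p hpS, Function.update_self]
      exact Nat.lt_succ_of_le (Finset.le_sup hpS)
    exact ⟨fun b hb => (hw _ (pos_pred_mem hb)).le, fun p hp => hw p (aggPreds_subset _ hp)⟩
  · exact Rule.Stratified.congr (hl r hr) fun p hp =>
      hne p (Program.rule_preds_subset (P := ⟨l, W₁ ++ w :: W₂⟩) hr hp)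

theorem weak_safe {l : List Rule} {W₁ W₂ : List WeakConstraint} {w : WeakConstraint} {temp : Pred}
    (hP : Program.Safe ⟨l, W₁ ++ w :: W₂⟩) :
    Program.Safe ⟨w.tempRule temp :: l, W₁ ++ w.tempConstraint temp :: W₂⟩ := by
  obtain ⟨h1, h2⟩ := hP
  refine ⟨fun r hr => ?_, fun v hv => ?_⟩
  · rcases List.mem_cons.1 hr with rfl | hr
    · have := h2 w (by simp)
      rw [WeakConstraint.Safe, ← w.tempRule_globals temp] at this
      exact this
    · exact h1 r hr
  · simp only [List.mem_append, List.mem_cons] at hv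
    rcases hv with hv | rfl | hv
    · exact h2 v (by simp [hv])
    · refine ⟨fun x hx => .pos (List.mem_singleton_self _) ?_, ?_⟩
      · simpa [WeakConstraint.tempConstraint, WeakConstraint.globals, outerVars, Elt.outerVars,
          Atom.vars] using hx
      · simp [bodyAggSafe_iff, WeakConstraint.tempConstraint, Elt.AggSafe]
    · exact h2 v (by simp [hv])

/-- The arguments of `temp` are the whole annotation, so its true atoms are the cost tuples of `w`,
although the substitutions that produce them may differ. -/
theorem weak_costTuples {l : List Rule} {W₁ W₂ : List WeakConstraint}
    {w : WeakConstraint} {temp : Pred} (h : temp ∉ Program.preds ⟨l, W₁ ++ w :: W₂⟩)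
    {I : Interp} (hI : ∀ a ∈ I, a.1 ∈ Program.preds ⟨l, W₁ ++ w :: W₂⟩) :
    Program.costTuples ⟨w.tempRule temp :: l, W₁ ++ w.tempConstraint temp :: W₂⟩
      (closure [w.tempRule temp] I I) = Program.costTuples ⟨l, W₁ ++ w :: W₂⟩ I := by
  set P : Program := ⟨l, W₁ ++ w :: W₂⟩
  have hag : AgreeOn P.preds (closure [w.tempRule temp] I I) I := fun a ha =>
    mem_closure_iff (by simpa [WeakConstraint.tempRule] using h) ha
  have hfires : ∀ s, (w.tempRule temp).Fires I (closure [w.tempRule temp] I I) s ↔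
      bodyHolds I w.globals s w.body := by
    intro s
    have hsub : (w.tempRule temp).body.Forall fun e => (e.preds : Set Pred) ⊆ P.preds :=
      List.forall_iff_forall_mem.2 fun e he p hp =>
        Program.mem_preds.2 (.inr ⟨w, by simp [P], mem_bodyPreds.2 ⟨e, he, hp⟩⟩)
    rw [bodyHolds_iff, Rule.Fires, w.tempRule_globals]
    refine forall₂_congr fun e he => ?_
    rw [← Elt.holdsRed_self]
    exact Elt.holdsRed_congr (.refl _ _)
      (hag.mono (List.forall_iff_forall_mem.1 hsub e he)) (fun _ _ => Iff.rfl) (fun _ _ => rfl)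
      fun _ _ _ => rfl
  have hother : ∀ v ∈ P.weak, ∀ s, bodyHolds (closure [w.tempRule temp] I I) v.globals s v.body ↔
      bodyHolds I v.globals s v.body := by
    intro v hv s
    simp only [bodyHolds_iff]
    refine forall₂_congr fun e he => Elt.holds_congr e (hag.mono fun p hp => ?_)
      (fun _ _ => Iff.rfl) (fun _ _ => rfl) fun _ _ _ => rfl
    exact Program.mem_preds.2 (.inr ⟨v, hv, mem_bodyPreds.2 ⟨e, he, hp⟩⟩)
  ext c
  constructor
  · rintro ⟨v, hv, s, hs, rfl⟩
    simp only [List.mem_append, List.mem_cons] at hv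
    have hv' : v ∈ P.weak ∨ v = w.tempConstraint temp := by
      simp only [P, List.mem_append, List.mem_cons]
      tauto
    rcases hv' with hv | rfl
    · exact ⟨v, hv, s, (hother v hv s).1 hs, rfl⟩
    · simp only [WeakConstraint.tempConstraint, bodyHolds, Elt.Holds, and_true] at hs
      rcases closure_inv hs with hs | ⟨r, hr, a, s', hh, heq, hf⟩
      · exact (h (hI _ hs)).elim
      · rw [List.mem_singleton] at hr
        subst hr
        simp only [WeakConstraint.tempRule, List.cons.injEq, and_true] at hh
        subst hh
        exact ⟨w, by simp [P], s', (hfires s').1 hf, (congrArg Prod.snd heq).symm⟩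
  · rintro ⟨v, hv, s, hs, rfl⟩
    -- The list may contain further copies of `w`, so the distinction is by equality and not by
    -- position.
    by_cases hvw : v = w
    · subst hvw
      refine ⟨v.tempConstraint temp, by simp, s, ?_, rfl⟩
      simp only [WeakConstraint.tempConstraint, bodyHolds, Elt.Holds, and_true]
      exact closure_step (List.mem_singleton_self _) rfl ((hfires s).2 hs)
    · refine ⟨v, ?_, s, (hother v hv s).2 hs, rfl⟩
      simp only [P, List.mem_append, List.mem_cons] at hv ⊢
      tauto

theorem weak_refines {l : List Rule} {W₁ W₂ : List WeakConstraint}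
    {w : WeakConstraint} {temp : Pred} (h : temp ∉ Program.preds ⟨l, W₁ ++ w :: W₂⟩)
    (hs : Program.Safe ⟨l, W₁ ++ w :: W₂⟩)
    (hP : Program.NonrecursiveAggregates ⟨l, W₁ ++ w :: W₂⟩) :
    Program.Refines ⟨w.tempRule temp :: l, W₁ ++ w.tempConstraint temp :: W₂⟩
      ⟨l, W₁ ++ w :: W₂⟩ := by
  have hext := weak_definitionalExtension h
  have hQ := weak_nonrecursive (W' := W₁ ++ w.tempConstraint temp :: W₂) h hP
  refine ⟨hext.preds_subset, weak_safe hs, hQ, hext.bijOn hP hQ, fun I hI => ?_⟩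
  rw [Program.weight, Program.weight, ← weak_costTuples h fun a ha => ha.2, hext.eq_closure hQ hI]

/-! ### Splitting an aggregate -/

namespace AggPartition

variable {G : Finset Var} {tup : List Term} {φ ψ ψ' : List Elt} {args : List Term}

theorem mem_iff (hp : AggPartition G tup φ ψ ψ' args) {e : Elt} : e ∈ φ ↔ e ∈ ψ ∨ e ∈ ψ' := by
  rw [hp.perm.mem_iff, List.mem_append]

theorem mem_aggScope (hp : AggPartition G tup φ ψ ψ' args) {x : Var} :
    x ∈ aggScope tup φ ↔ x ∈ termsVars tup ∨ x ∈ outerVars ψ ∨ x ∈ outerVars ψ' := by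
  simp only [aggScope, Finset.mem_union, mem_outerVars, hp.mem_iff, or_and_right, exists_or]

theorem mem_aggScope_split {temp : Pred} {x : Var} :
    x ∈ aggScope tup (ψ ++ [.pos ⟨temp, args⟩]) ↔
      x ∈ termsVars tup ∨ x ∈ outerVars ψ ∨ x ∈ termsVars args := by
  rw [aggScope, outerVars_append]
  simp [outerVars, Elt.outerVars, Atom.vars]

theorem mem_args (hp : AggPartition G tup φ ψ ψ' args) {x : Var} (h1 : x ∈ bodyVars ψ')
    (h2 : x ∈ aggScope tup φ) (h3 : x ∈ bodyVars ψ ∨ x ∈ termsVars tup) : x ∈ termsVars args :=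
  hp.relevant (by simp only [Finset.mem_inter, Finset.mem_union]; exact ⟨⟨h1, h2⟩, h3⟩)

/-- A variable of `ψ` that was in the scope only through `ψ'` is relevant, thus an argument of
`temp`. So aggregates nested in `ψ` receive the same variables from outside as before. -/
theorem mem_known_split_iff (hp : AggPartition G tup φ ψ ψ' args) {temp : Pred} {x : Var}
    (hx : x ∈ bodyVars ψ) :
    x ∈ G ∪ aggScope tup φ ↔ x ∈ G ∪ aggScope tup (ψ ++ [.pos ⟨temp, args⟩]) := by
  rw [Finset.mem_union, Finset.mem_union, mem_aggScope_split]
  constructor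
  · rintro (h | h)
    · exact .inl h
    · rcases hp.mem_aggScope.1 h with h' | h' | h'
      · exact .inr (.inl h')
      · exact .inr (.inr (.inl h'))
      · exact .inr (.inr (.inr (hp.mem_args (outerVars_subset_bodyVars _ h') h (.inl hx))))
  · rintro (h | h | h | h)
    · exact .inl h
    · exact .inr (hp.mem_aggScope.2 (.inl h))
    · exact .inr (hp.mem_aggScope.2 (.inr (.inl h)))
    · simpa using hp.args_subset h

/-- The analogue for `ψ'` moved to a rule of its own: by `inner` it has no variables of `G`, and its
scope variables are either its own outer variables or relevant, hence arguments. -/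
theorem mem_known_iff_mem_globals (hp : AggPartition G tup φ ψ ψ' args) {x : Var}
    (hx : x ∈ bodyVars ψ') :
    x ∈ G ∪ aggScope tup φ ↔ x ∈ termsVars args ∪ outerVars ψ' := by
  rw [Finset.mem_union, Finset.mem_union]
  constructor
  · rintro (h | h)
    · exact absurd h (Finset.disjoint_left.1 hp.inner hx)
    · rcases hp.mem_aggScope.1 h with h' | h' | h'
      · exact .inl (hp.mem_args hx h (.inr h'))
      · exact .inl (hp.mem_args hx h (.inl (outerVars_subset_bodyVars _ h')))
      · exact .inr h'
  · rintro (h | h)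
    · simpa using hp.args_subset h
    · exact .inr (hp.mem_aggScope.2 (.inr (.inr h)))

end AggPartition

theorem preAggRule_globals (temp : Pred) (args : List Term) (ψ' : List Elt) :
    (preAggRule temp args ψ').globals = termsVars args ∪ outerVars ψ' := by
  simp [preAggRule, Rule.globals, atomsVars, Atom.vars]

theorem Rule.unsafeVars_subset (r : Rule) : r.unsafeVars ⊆ r.globals := by
  classical exact Finset.filter_subset _ _

/-- The rule `temp(args) ← ψ'` with domain predicates. -/
noncomputable def aggRule (dom : Var → Pred) (temp : Pred) (args : List Term) (ψ' : List Elt) :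
    Rule :=
  ⟨[⟨temp, args⟩], ψ' ++ domAtoms dom (preAggRule temp args ψ').unsafeVars⟩

theorem aggRule_globals (dom : Var → Pred) (temp : Pred) (args : List Term) (ψ' : List Elt) :
    (aggRule dom temp args ψ').globals = termsVars args ∪ outerVars ψ' := by
  have h := (preAggRule temp args ψ').unsafeVars_subset
  rw [preAggRule_globals] at h
  rw [aggRule, Rule.globals, outerVars_append, outerVars_domAtoms, ← Finset.union_assoc,
    Finset.union_eq_left.2]
  · simp [atomsVars, Atom.vars]
  · simpa [atomsVars, Atom.vars] using h

-- The rules generated by a split, and equivalence of the split aggregate.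

section AggRules

variable {used : Finset Pred} {B ψ' : List Elt} {args : List Term} {temp : Pred} {R : List Rule}

theorem AggRules.head (hR : AggRules used B ψ' args temp R) :
    ∀ r ∈ R, ∃ h : Atom, r.head = [h] ∧ h.pred ∉ used := by
  obtain ⟨dom, A, ht, -, hd, rfl⟩ := hR
  intro r hr
  rcases List.mem_cons.1 hr with rfl | hr
  · exact ⟨_, rfl, ht⟩
  · obtain ⟨x, hx, rfl⟩ := mem_domRules.1 hr
    exact ⟨_, rfl, (hd x hx).1⟩

theorem AggRules.head_fresh (hR : AggRules used B ψ' args temp R) :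
    ∀ r ∈ R, ∀ h ∈ r.head, h.pred ∉ used := by
  intro r hr a ha
  obtain ⟨b, hb, hb'⟩ := hR.head r hr
  rw [hb, List.mem_singleton] at ha
  exact ha ▸ hb'

theorem AggRules.tests (hR : AggRules used B ψ' args temp R) (hu : bodyPreds ψ' ⊆ used) :
    ∀ r ∈ R, ∀ e ∈ r.body, ¬ e.IsPos → e.preds ⊆ used := by
  obtain ⟨dom, A, ht, -, hd, rfl⟩ := hR
  intro r hr e he hp
  rcases List.mem_cons.1 hr with rfl | hr
  · rcases List.mem_append.1 he with he | he
    · exact fun p hp => hu (mem_bodyPreds.2 ⟨e, he, hp⟩)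
    · obtain ⟨x, -, rfl⟩ := mem_domAtoms.1 he
      exact absurd trivial hp
  · obtain ⟨x, hx, rfl⟩ := mem_domRules.1 hr
    rw [((hd x hx).2.2.mem e he).2.preds_eq_empty hp]
    exact Finset.empty_subset _

theorem AggRules.mem_closure (hR : AggRules used B ψ' args temp R)
    {I : Interp} {s : Subst} {G : Finset Var}
    (hB : ∀ e ∈ B, e.IsSimple → e.Holds I G s)
    (hψ : ∀ e ∈ ψ', e.Holds I (termsVars args ∪ outerVars ψ') s) :
    Atom.subst s ⟨temp, args⟩ ∈ closure R I I := by
  obtain ⟨dom, A, ht, -, hd, rfl⟩ := hR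
  refine closure_step (r := aggRule dom temp args ψ') List.mem_cons_self rfl fun e he => ?_
  rw [aggRule_globals]
  rcases List.mem_append.1 he with he | he
  · exact (Elt.holdsRed_self.2 (hψ e he)).mono subset_closure
  · obtain ⟨x, hx, rfl⟩ := mem_domAtoms.1 he
    exact (hd x hx).2.2.mem_closure
      (List.mem_cons_of_mem _ (mem_domRules.2 ⟨x, hx, rfl⟩))
      fun e he hs => Elt.holdsRed_self.2 (hB e he hs)

/-- The predicate `temp` heads a single rule, so a true atom comes from an instance of it. The
substitution is recovered only on the arguments. -/
theorem AggRules.exists_of_mem_closure (hR : AggRules used B ψ' args temp R)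
    (hu : bodyPreds ψ' ⊆ used) {I : Interp} (hI : ∀ a ∈ I, a.1 ∈ used) {s : Subst}
    (h : Atom.subst s ⟨temp, args⟩ ∈ closure R I I) :
    ∃ s' : Subst, (∀ x ∈ termsVars args, s' x = s x) ∧
      ∀ e ∈ ψ', e.Holds I (termsVars args ∪ outerVars ψ') s' := by
  have hfresh := hR.head_fresh
  obtain ⟨dom, A, ht, -, hd, rfl⟩ := hR
  rcases closure_inv h with h | ⟨r, hr, a, s', hh, heq, hf⟩
  · exact (ht (hI _ h)).elim
  rcases List.mem_cons.1 hr with rfl | hr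
  · simp only [List.cons.injEq, and_true] at hh
    subst hh
    refine ⟨s', fun x hx => eq_of_map_subst_eq (congrArg Prod.snd heq) hx, fun e he => ?_⟩
    have := hf e (List.mem_append_left _ he)
    rw [← aggRule, aggRule_globals] at this
    have hag : AgreeOn e.preds (closure (aggRule dom temp args ψ' ::
        domRules dom A (preAggRule temp args ψ').unsafeVars) I I) I := fun a ha =>
      mem_closure_iff hfresh (hu (mem_bodyPreds.2 ⟨e, he, ha⟩))
    exact Elt.holdsRed_self.1 ((Elt.holdsRed_congr (.refl _ _) hag (fun _ _ => Iff.rfl)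
      (fun _ _ => rfl) fun _ _ _ => rfl).1 this)
  · obtain ⟨x, hx, rfl⟩ := mem_domRules.1 hr
    simp only [List.cons.injEq, and_true] at hh
    subst hh
    exact ((hd x hx).2.1 (congrArg Prod.fst heq).symm).elim

/-- The simple elements of the context `C` have to be true because domain rules may be selected from
them; otherwise `temp` might miss solutions of `ψ'`. -/
theorem AggRules.holds_iff {G : Finset Var} {C : List Elt} {t : Term} {cmp : Cmp} {f : AggFun}
    {tup : List Term} {φ ψ : List Elt} (hp : AggPartition G tup φ ψ ψ' args) (hB : B ⊆ C ++ φ)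
    (hR : AggRules used B ψ' args temp R) (hu : bodyPreds φ ⊆ used) (hC : outerVars C ⊆ G)
    {I : Interp} (hI : ∀ a ∈ I, a.1 ∈ used) {s : Subst}
    (hs : ∀ c ∈ C, c.IsSimple → c.Holds I G s) :
    (Elt.agg t cmp f tup φ).Holds I G s ↔
      (Elt.agg t cmp f tup (ψ ++ [.pos ⟨temp, args⟩])).Holds (closure R I I) G s := by
  have hsub : ∀ e, e ∈ ψ ∨ e ∈ ψ' → e.preds ⊆ used := fun e he p hp' =>
    hu (mem_bodyPreds.2 ⟨e, hp.mem_iff.2 he, hp'⟩)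
  have huψ' : bodyPreds ψ' ⊆ used := fun p hp' => by
    obtain ⟨e, he, hp'⟩ := mem_bodyPreds.1 hp'
    exact hsub e (.inr he) hp'
  have hag : ∀ e, e ∈ ψ ∨ e ∈ ψ' → AgreeOn e.preds I (closure R I I) := fun e he a ha =>
    (mem_closure_iff hR.head_fresh (hsub e he ha)).symm
  have hset : {c | ∃ s₁ : Subst, (∀ x ∈ G, s₁ x = s x) ∧
        bodyHolds I (G ∪ aggScope tup φ) s₁ φ ∧ c = tup.map (Term.subst s₁)} =
      {c | ∃ s₁ : Subst, (∀ x ∈ G, s₁ x = s x) ∧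
        bodyHolds (closure R I I) (G ∪ aggScope tup (ψ ++ [.pos ⟨temp, args⟩])) s₁
          (ψ ++ [.pos ⟨temp, args⟩]) ∧ c = tup.map (Term.subst s₁)} := by
    ext c
    constructor
    · rintro ⟨s₁, hs₁, hb, rfl⟩
      rw [bodyHolds_iff] at hb
      refine ⟨s₁, hs₁, bodyHolds_iff.2 fun e he => ?_, rfl⟩
      rcases List.mem_append.1 he with he | he
      · refine (Elt.holds_congr e (hag e (.inl he)) (fun x hx => ?_) (fun _ _ => rfl)
          fun _ _ _ => rfl).1 (hb e (hp.mem_iff.2 (.inl he)))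
        exact hp.mem_known_split_iff (mem_bodyVars.2 ⟨e, he, hx⟩)
      · rw [List.mem_singleton] at he
        subst he
        rw [Elt.Holds]
        -- Elements selected from the context are true under `s`, and `s₁` agrees with `s` on their
        -- variables, which lie in `G`; those selected from `φ` are true under `s₁` itself.
        refine hR.mem_closure (G := G ∪ aggScope tup φ) (fun e he hes => ?_) fun e he => ?_
        · rcases List.mem_append.1 (hB he) with he | he
          · exact (hes.holds_congr fun x hx =>
              (hs₁ x (hC (mem_outerVars.2 ⟨e, he, hx⟩))).symm).1 (hs e he hes)
          · exact hb e he
        · refine (Elt.holds_congr e (.refl _ _) (fun x hx => ?_) (fun _ _ => rfl)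
            fun _ _ _ => rfl).1 (hb e (hp.mem_iff.2 (.inr he)))
          exact hp.mem_known_iff_mem_globals (mem_bodyVars.2 ⟨e, he, hx⟩)
    · rintro ⟨s₁, hs₁, hb, rfl⟩
      rw [bodyHolds_iff] at hb
      have ht := hb (.pos ⟨temp, args⟩) (by simp)
      rw [Elt.Holds] at ht
      obtain ⟨s₂, hs₂, hψ'⟩ := hR.exists_of_mem_closure huψ' hI ht
      -- The solution `s₂` of `ψ'` is used on the scope variables of `ψ'`, and `s₁` elsewhere. Where
      -- such a variable also occurs in `ψ` or the tuple it is an argument of `temp`, so the two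
      -- agree. Variables outside the scope are left to `s₁`, as relevance says nothing about them.
      set s₃ : Subst := fun x => if x ∈ bodyVars ψ' ∧ x ∈ aggScope tup φ then s₂ x else s₁ x
      have h₁ : ∀ x, x ∈ bodyVars ψ ∨ x ∈ termsVars tup → s₁ x = s₃ x := by
        intro x hx
        simp only [s₃]
        split_ifs with h
        · exact (hs₂ x (hp.mem_args h.1 h.2 hx)).symm
        · rfl
      refine ⟨s₃, fun x hx => ?_, bodyHolds_iff.2 fun e he => ?_,
        map_subst_congr fun x hx => h₁ x (.inr hx)⟩
      · simp only [s₃]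
        rw [if_neg fun h => Finset.disjoint_left.1 hp.inner h.1 hx]
        exact hs₁ x hx
      · rcases hp.mem_iff.1 he with he | he
        · refine (Elt.holds_congr e (hag e (.inl he)) (fun x hx => ?_) (fun x hx => ?_)
            fun x hx _ => ?_).2 (hb e (List.mem_append_left _ he))
          · exact hp.mem_known_split_iff (mem_bodyVars.2 ⟨e, he, hx⟩)
          · exact (h₁ x (.inl (mem_bodyVars.2 ⟨e, he, e.outerVars_subset hx⟩))).symm
          · exact (h₁ x (.inl (mem_bodyVars.2 ⟨e, he, hx⟩))).symm
        · have hk : ∀ x ∈ e.vars, x ∈ G ∪ aggScope tup φ ↔ x ∈ termsVars args ∪ outerVars ψ' :=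
            fun x hx => hp.mem_known_iff_mem_globals (mem_bodyVars.2 ⟨e, he, hx⟩)
          have h₂ : ∀ x ∈ e.vars, x ∈ G ∪ aggScope tup φ → s₃ x = s₂ x := by
            intro x hx hxG
            have hxb : x ∈ bodyVars ψ' := mem_bodyVars.2 ⟨e, he, hx⟩
            refine if_pos ⟨hxb, (Finset.mem_union.1 hxG).resolve_left
              (Finset.disjoint_left.1 hp.inner hxb)⟩
          refine (Elt.holds_congr e (.refl _ _) hk (fun x hx => ?_) h₂).2 (hψ' e he)
          exact h₂ x (e.outerVars_subset hx) ((hk x (e.outerVars_subset hx)).2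
            (Finset.mem_union_right _ (mem_outerVars.2 ⟨e, he, hx⟩)))
  rw [Elt.Holds, Elt.Holds, hset]

theorem AggRules.safe (hR : AggRules used B ψ' args temp R)
    (hs : bodyAggSafe (termsVars args ∪ outerVars ψ') ψ') : ∀ r ∈ R, r.Safe := by
  obtain ⟨dom, A, ht, -, hd, rfl⟩ := hR
  intro r hr
  rcases List.mem_cons.1 hr with rfl | hr
  · rw [← aggRule]
    refine ⟨fun x hx => ?_, bodyAggSafe_iff.2 fun e he => ?_⟩
    · by_cases hxu : x ∈ (preAggRule temp args ψ').unsafeVars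
      · exact .pos (List.mem_append_right _ (mem_domAtoms.2 ⟨x, hxu, rfl⟩))
          (by simp [Atom.vars, mem_termsVars, Term.vars])
      · rw [aggRule_globals, ← preAggRule_globals temp] at hx
        simp only [Rule.unsafeVars, Finset.mem_filter, not_and, not_not] at hxu
        exact (hxu hx).mono (List.subset_append_left _ _) subset_rfl
    · rw [aggRule_globals]
      rcases List.mem_append.1 he with he | he
      · exact bodyAggSafe_iff.1 hs e he
      · obtain ⟨x, -, rfl⟩ := mem_domAtoms.1 he
        trivial
  · obtain ⟨x, hx, rfl⟩ := mem_domRules.1 hr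
    exact (hd x hx).2.2.domRule_safe _

end AggRules

/-- A safety derivation in `φ` for a variable of `ψ` or the tuple is followed as long as it uses
`ψ`. Where it first uses an element of `ψ'`, the current variable is relevant, and the `temp` atom
binds it directly. -/
theorem AggPartition.aggSafe {G : Finset Var} {t : Term} {cmp : Cmp} {f : AggFun}
    {tup args : List Term} {φ ψ ψ' : List Elt} (hp : AggPartition G tup φ ψ ψ' args) {temp : Pred}
    (h : (Elt.agg t cmp f tup φ).AggSafe G) :
    (Elt.agg t cmp f tup (ψ ++ [.pos ⟨temp, args⟩])).AggSafe G ∧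
      bodyAggSafe (termsVars args ∪ outerVars ψ') ψ' := by
  rw [Elt.AggSafe, bodyAggSafe_iff] at h
  obtain ⟨h1, h2⟩ := h
  have htemp : ∀ x ∈ termsVars args, Bound (ψ ++ [.pos ⟨temp, args⟩]) G x := fun x hx =>
    .pos (a := ⟨temp, args⟩) (by simp) hx
  have hb : ∀ x, Bound φ G x → x ∈ aggScope tup φ → x ∈ outerVars ψ ∨ x ∈ termsVars tup →
      Bound (ψ ++ [.pos ⟨temp, args⟩]) G x := by
    intro x hx
    induction hx with
    | known hx => exact fun _ _ => .known hx
    | @pos a x ha hx =>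
      intro hsc hx'
      rcases hp.mem_iff.1 ha with ha | ha
      · exact .pos (List.mem_append_left _ ha) hx
      · exact htemp x (hp.mem_args (mem_bodyVars.2 ⟨_, ha, hx⟩) hsc
          (hx'.imp_left fun h => outerVars_subset_bodyVars _ h))
    | @arith x e he _ ih =>
      intro hsc hx'
      rcases hp.mem_iff.1 he with he' | he'
      · refine .arith (List.mem_append_left _ he') fun y hy => ?_
        have hyψ : y ∈ outerVars ψ := mem_outerVars.2 ⟨_, he', by simp [Elt.outerVars, hy]⟩
        exact ih y hy (hp.mem_aggScope.2 (.inr (.inl hyψ))) (.inl hyψ)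
      · exact htemp x (hp.mem_args (mem_bodyVars.2 ⟨_, he', by simp [Elt.vars, Term.vars]⟩) hsc
          (hx'.imp_left fun h => outerVars_subset_bodyVars _ h))
  rw [Elt.AggSafe, bodyAggSafe_iff, bodyAggSafe_iff]
  refine ⟨⟨fun x hx => ?_, fun e he => ?_⟩, fun e he => ?_⟩
  · rcases AggPartition.mem_aggScope_split.1 hx with hx | hx | hx
    · have := hp.mem_aggScope.2 (.inl hx)
      exact hb x (h1 x this) this (.inr hx)
    · have := hp.mem_aggScope.2 (.inr (.inl hx))
      exact hb x (h1 x this) this (.inl hx)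
    · exact htemp x hx
  · rcases List.mem_append.1 he with he | he
    · exact Elt.AggSafe.mono e (fun x hx => (hp.mem_known_split_iff
        (mem_bodyVars.2 ⟨e, he, hx⟩)).1) (h2 e (hp.mem_iff.2 (.inl he)))
    · rw [List.mem_singleton] at he
      subst he
      trivial
  · exact Elt.AggSafe.mono e (fun x hx => (hp.mem_known_iff_mem_globals
      (mem_bodyVars.2 ⟨e, he, hx⟩)).1) (h2 e (hp.mem_iff.2 (.inr he)))

-- Splits of aggregates that may be nested.

namespace AggRewrite

variable {used : Finset Pred} {G : Finset Var} {C : List Elt} {e e' : Elt} {R : List Rule}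

theorem outerVars_eq (h : AggRewrite used G C e e' R) : e'.outerVars = e.outerVars := by
  cases h <;> rfl

theorem not_isSimple (h : AggRewrite used G C e e' R) : ¬ e.IsSimple ∧ ¬ e'.IsSimple := by
  cases h <;> exact ⟨id, id⟩

theorem not_isPos (h : AggRewrite used G C e e' R) : ¬ e.IsPos ∧ ¬ e'.IsPos := by
  cases h <;> exact ⟨id, id⟩

theorem exists_aggRules (h : AggRewrite used G C e e' R) :
    ∃ B ψ' args temp, AggRules used B ψ' args temp R ∧ bodyPreds ψ' ⊆ e.preds := by
  induction h with
  | here hp hB hR =>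
    refine ⟨_, _, _, _, hR, fun p hp' => ?_⟩
    obtain ⟨e, he, hp'⟩ := mem_bodyPreds.1 hp'
    rw [Elt.preds]
    exact mem_bodyPreds.2 ⟨e, hp.mem_iff.2 (.inr he), hp'⟩
  | inside _ ih =>
    obtain ⟨B, ψ', args, temp, hR, hsub⟩ := ih
    refine ⟨B, ψ', args, temp, hR, hsub.trans fun p hp => ?_⟩
    rw [Elt.preds]
    exact mem_bodyPreds.2 ⟨_, by simp, hp⟩

theorem preds_subset (h : AggRewrite used G C e e' R) :
    ∀ p ∈ e.preds, p ∈ e'.preds ∨ ∃ r ∈ R, p ∈ r.preds := by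
  induction h with
  | here hp hB hR =>
    intro p hpp
    rw [Elt.preds] at hpp ⊢
    obtain ⟨e, he, hpe⟩ := mem_bodyPreds.1 hpp
    rcases hp.mem_iff.1 he with he | he
    · exact .inl (mem_bodyPreds.2 ⟨e, List.mem_append_left _ he, hpe⟩)
    · obtain ⟨dom, A, -, -, -, rfl⟩ := hR
      exact .inr ⟨_, List.mem_cons_self, Finset.mem_union_right _
        (mem_bodyPreds.2 ⟨e, List.mem_append_left _ he, hpe⟩)⟩
  | @inside G C t cmp f tup l₁ l₂ e e' R _ ih =>
    intro p hpp
    rw [Elt.preds] at hpp ⊢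
    obtain ⟨c, hc, hpc⟩ := mem_bodyPreds.1 hpp
    simp only [List.mem_append, List.mem_cons] at hc
    rcases hc with hc | rfl | hc
    · exact .inl (mem_bodyPreds.2 ⟨c, by simp [hc], hpc⟩)
    · exact (ih p hpc).imp_left fun h => mem_bodyPreds.2 ⟨e', by simp, h⟩
    · exact .inl (mem_bodyPreds.2 ⟨c, by simp [hc], hpc⟩)

theorem outerVars_replace (h : AggRewrite used G C e e' R) (l₁ l₂ : List Elt) :
    outerVars (l₁ ++ e' :: l₂) = outerVars (l₁ ++ e :: l₂) := by
  ext x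
  simp only [mem_outerVars, List.mem_append, List.mem_cons, or_and_right, exists_or,
    exists_eq_left, h.outerVars_eq]

theorem bound_replace (h : AggRewrite used G C e e' R) {l₁ l₂ : List Elt} {K : Finset Var}
    {x : Var} (hx : Bound (l₁ ++ e :: l₂) K x) : Bound (l₁ ++ e' :: l₂) K x := by
  have hmem : ∀ c : Elt, c.IsSimple → c ∈ l₁ ++ e :: l₂ → c ∈ l₁ ++ e' :: l₂ := by
    intro c hcs hc
    simp only [List.mem_append, List.mem_cons] at hc ⊢
    rcases hc with hc | rfl | hc
    · exact .inl hc
    · exact absurd hcs h.not_isSimple.1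
    · exact .inr (.inr hc)
  induction hx with
  | known hx => exact .known hx
  | pos ha hx => exact .pos (hmem _ trivial ha) hx
  | arith he _ ih => exact .arith (hmem _ trivial he) ih

/-- Going inside an aggregate enlarges the context by its body. The equivalence is needed only for
substitutions that make the other elements of this body true, which is the assumption on the context
one level deeper. -/
theorem holds_iff (h : AggRewrite used G C e e' R) (hu : e.preds ⊆ used) (hC : outerVars C ⊆ G)
    {I : Interp} (hI : ∀ a ∈ I, a.1 ∈ used) {s : Subst}
    (hs : ∀ c ∈ C, c.IsSimple → c.Holds I G s) :
    e.Holds I G s ↔ e'.Holds (closure R I I) G s := by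
  induction h generalizing s with
  | here hp hB hR => exact hR.holds_iff hp hB (by rwa [Elt.preds] at hu) hC hI hs
  | @inside G C t cmp f tup l₁ l₂ e e' R h ih =>
    rw [Elt.preds] at hu
    have hfresh : ∀ r ∈ R, ∀ h ∈ r.head, h.pred ∉ used := by
      obtain ⟨B, ψ', args, temp, hR, -⟩ := h.exists_aggRules
      exact hR.head_fresh
    have hsc : aggScope tup (l₁ ++ e' :: l₂) = aggScope tup (l₁ ++ e :: l₂) := by
      rw [aggScope, aggScope, h.outerVars_replace]
    have hother : ∀ c ∈ l₁ ++ l₂, ∀ s₁, c.Holds I (G ∪ aggScope tup (l₁ ++ e :: l₂)) s₁ ↔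
        c.Holds (closure R I I) (G ∪ aggScope tup (l₁ ++ e :: l₂)) s₁ := by
      refine fun c hc s₁ => Elt.holds_congr c (fun a ha => ?_) (fun _ _ => Iff.rfl)
        (fun _ _ => rfl) fun _ _ _ => rfl
      refine (mem_closure_iff hfresh (hu (mem_bodyPreds.2 ⟨c, ?_, ha⟩))).symm
      simp only [List.mem_append, List.mem_cons] at hc ⊢
      tauto
    have hbody : ∀ s₁ : Subst, (∀ x ∈ G, s₁ x = s x) →
        (bodyHolds I (G ∪ aggScope tup (l₁ ++ e :: l₂)) s₁ (l₁ ++ e :: l₂) ↔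
          bodyHolds (closure R I I) (G ∪ aggScope tup (l₁ ++ e' :: l₂)) s₁
            (l₁ ++ e' :: l₂)) := by
      intro s₁ hs₁
      rw [hsc, bodyHolds_iff, bodyHolds_iff]
      have hsplit : ∀ (c₀ : Elt) (p : Elt → Prop),
          (∀ c ∈ l₁ ++ c₀ :: l₂, p c) ↔ (∀ c ∈ l₁ ++ l₂, p c) ∧ p c₀ := by
        intro c₀ p
        simp only [List.mem_append, List.mem_cons]
        refine ⟨fun h => ⟨fun c hc => h c (by tauto), h c₀ (by simp)⟩, ?_⟩
        rintro ⟨h1, h2⟩ c (hc | rfl | hc)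
        exacts [h1 c (.inl hc), h2, h1 c (.inr hc)]
      rw [hsplit, hsplit, ← forall₂_congr fun c hc => hother c hc s₁]
      refine and_congr_right fun hl => ih (fun p hp => hu (mem_bodyPreds.2 ⟨e, by simp, hp⟩))
        ?_ fun c hc hcs => ?_
      · rw [outerVars_append]
        refine Finset.union_subset_union hC ?_
        exact Finset.subset_union_right
      · rcases List.mem_append.1 hc with hc | hc
        · exact (hcs.holds_congr fun x hx =>
            (hs₁ x (hC (mem_outerVars.2 ⟨c, hc, hx⟩))).symm).1 (hs c hc hcs)
        · simp only [List.mem_append, List.mem_cons] at hc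
          rcases hc with hc | rfl | hc
          · exact hl c (by simp [hc])
          · exact absurd hcs h.not_isSimple.1
          · exact hl c (by simp [hc])
    have hset : {c | ∃ s₁ : Subst, (∀ x ∈ G, s₁ x = s x) ∧
          bodyHolds I (G ∪ aggScope tup (l₁ ++ e :: l₂)) s₁ (l₁ ++ e :: l₂) ∧
          c = tup.map (Term.subst s₁)} =
        {c | ∃ s₁ : Subst, (∀ x ∈ G, s₁ x = s x) ∧
          bodyHolds (closure R I I) (G ∪ aggScope tup (l₁ ++ e' :: l₂)) s₁ (l₁ ++ e' :: l₂) ∧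
          c = tup.map (Term.subst s₁)} := by
      ext c
      exact exists_congr fun s₁ => and_congr_right fun hs₁ => and_congr_left fun _ => hbody s₁ hs₁
    rw [Elt.Holds, Elt.Holds, hset]

theorem aggSafe (h : AggRewrite used G C e e' R) (hs : e.AggSafe G) :
    e'.AggSafe G ∧ ∀ r ∈ R, r.Safe := by
  induction h with
  | @here G C B t cmp f tup φ ψ ψ' args temp R hp hB hR =>
    have := hp.aggSafe (temp := temp) hs
    exact ⟨this.1, hR.safe this.2⟩
  | @inside G C t cmp f tup l₁ l₂ e e' R h ih =>
    rw [Elt.AggSafe, bodyAggSafe_iff] at hs ⊢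
    have hsc : aggScope tup (l₁ ++ e' :: l₂) = aggScope tup (l₁ ++ e :: l₂) := by
      rw [aggScope, aggScope, h.outerVars_replace]
    have he := ih (hs.2 e (by simp))
    rw [hsc]
    refine ⟨⟨fun x hx => h.bound_replace (hs.1 x hx), fun c hc => ?_⟩, he.2⟩
    simp only [List.mem_append, List.mem_cons] at hc
    rcases hc with hc | rfl | hc
    exacts [hs.2 c (by simp [hc]), he.1, hs.2 c (by simp [hc])]

theorem definitionalExtension {l₁ l₂ : List Rule} {W : List WeakConstraint} {H : List Atom}
    {b₁ b₂ : List Elt}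
    (h : AggRewrite (Program.preds ⟨l₁ ++ ⟨H, b₁ ++ e :: b₂⟩ :: l₂, W⟩)
      (Rule.globals ⟨H, b₁ ++ e :: b₂⟩) (b₁ ++ e :: b₂) e e' R) :
    DefinitionalExtension ⟨l₁ ++ ⟨H, b₁ ++ e :: b₂⟩ :: l₂, W⟩
      ⟨l₁ ++ ⟨H, b₁ ++ e' :: b₂⟩ :: R ++ l₂, W⟩ R := by
  set P : Program := ⟨l₁ ++ ⟨H, b₁ ++ e :: b₂⟩ :: l₂, W⟩
  obtain ⟨B, ψ', args, temp, hR, hψ'⟩ := h.exists_aggRules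
  have hrule : ∀ r, r ∈ P.rules ↔ (r ∈ l₁ ∨ r ∈ l₂) ∨ r = ⟨H, b₁ ++ e :: b₂⟩ := by
    intro r
    simp only [P, List.mem_append, List.mem_cons]
    tauto
  have hbody : ∀ c ∈ b₁ ++ e :: b₂, c.preds ⊆ P.preds := fun c hc p hp =>
    Program.mem_preds.2 (.inl ⟨_, (hrule _).2 (.inr rfl), Finset.mem_union_right _
      (mem_bodyPreds.2 ⟨c, hc, hp⟩)⟩)
  have he : e.preds ⊆ P.preds := hbody e (by simp)
  have hfresh := hR.head_fresh
  have hglob : (Rule.mk H (b₁ ++ e' :: b₂)).globals = (Rule.mk H (b₁ ++ e :: b₂)).globals := by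
    rw [Rule.globals, Rule.globals, h.outerVars_replace]
  have hmem : ∀ (c₀ c : Elt), c ∈ b₁ ++ c₀ :: b₂ ↔ c ∈ b₁ ++ b₂ ∨ c = c₀ := by
    intro c₀ c
    simp only [List.mem_append, List.mem_cons]
    tauto
  have hmain : ∀ I J s, (∀ a ∈ I, a.1 ∈ P.preds) → J ⊆ I →
      ((Rule.mk H (b₁ ++ e :: b₂)).Fires I J s ↔
        (Rule.mk H (b₁ ++ e' :: b₂)).Fires (closure R I I) (closure R I J) s) := by
    intro I J s hI hJ
    simp only [Rule.Fires, hglob, hmem, or_imp, forall_and, forall_eq]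
    have hside : (∀ c ∈ b₁ ++ b₂, c.HoldsRed I J (Rule.mk H (b₁ ++ e :: b₂)).globals s) ↔
        ∀ c ∈ b₁ ++ b₂, c.HoldsRed (closure R I I) (closure R I J)
          (Rule.mk H (b₁ ++ e :: b₂)).globals s := by
      refine forall₂_congr fun c hc => ?_
      have hc' := hbody c ((hmem e c).2 (.inl hc))
      exact Elt.holdsRed_congr (fun a ha => (mem_closure_iff hfresh (hc' ha)).symm)
        (fun a ha => (mem_closure_iff hfresh (hc' ha)).symm) (fun _ _ => Iff.rfl)
        (fun _ _ => rfl) fun _ _ _ => rfl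
    rw [← hside]
    refine and_congr_right fun hs => ?_
    rw [Elt.holdsRed_of_not_isPos h.not_isPos.1, Elt.holdsRed_of_not_isPos h.not_isPos.2]
    refine h.holds_iff he Finset.subset_union_right hI fun c hc hcs => ?_
    rcases (hmem e c).1 hc with hc | rfl
    -- The aggregate is tested in `I`, so its context must be true in `I`; the positive literals are
    -- known in `J` only, and `J ⊆ I` carries them over.
    · exact Elt.holdsRed_self.1 ((hs c hc).mono hJ)
    · exact absurd hcs h.not_isSimple.1
  refine ⟨fun p hp => ?_, fun r hr => by simp [hr], hR.head, hR.tests (hψ'.trans he),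
    fun r hr => ?_, fun r hr => ?_⟩
  · rw [Program.mem_preds] at hp ⊢
    rcases hp with ⟨r, hr, hp⟩ | ⟨w, hw, hp⟩
    · rcases (hrule r).1 hr with hr | rfl
      · refine .inl ⟨r, ?_, hp⟩
        simp only [List.mem_append, List.mem_cons]
        tauto
      · rcases Finset.mem_union.1 hp with hp | hp
        · exact .inl ⟨⟨H, b₁ ++ e' :: b₂⟩, by simp, Finset.mem_union_left _ hp⟩
        · obtain ⟨c, hc, hpc⟩ := mem_bodyPreds.1 hp
          rcases (hmem e c).1 hc with hc | rfl
          · exact .inl ⟨⟨H, b₁ ++ e' :: b₂⟩, by simp, Finset.mem_union_right _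
              (mem_bodyPreds.2 ⟨c, (hmem e' c).2 (.inl hc), hpc⟩)⟩
          · rcases h.preds_subset p hpc with hp' | ⟨r, hr, hp'⟩
            · exact .inl ⟨⟨H, b₁ ++ e' :: b₂⟩, by simp, Finset.mem_union_right _
                (mem_bodyPreds.2 ⟨e', by simp, hp'⟩)⟩
            · exact .inl ⟨r, by simp [hr], hp'⟩
    · exact .inr ⟨w, hw, hp⟩
  · rcases (hrule r).1 hr with hr' | rfl
    · refine ⟨r, ?_, fun I J s _ _ hf => ⟨s, ?_, rfl⟩⟩
      · simp only [List.mem_append, List.mem_cons]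
        tauto
      · exact (Rule.fires_closure_of_preds_subset hfresh (Program.rule_preds_subset hr)).2 hf
    · exact ⟨⟨H, b₁ ++ e' :: b₂⟩, by simp, fun I J s hI hJ hf =>
        ⟨s, (hmain I J s hI hJ).1 hf, rfl⟩⟩
  · have hr' : r ∈ R ∨ (r ∈ l₁ ∨ r ∈ l₂) ∨ r = ⟨H, b₁ ++ e' :: b₂⟩ := by
      simp only [List.mem_append, List.mem_cons] at hr
      tauto
    rcases hr' with hr | hr | rfl
    · exact .inl hr
    · have hrP : r ∈ P.rules := (hrule r).2 (.inl hr)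
      exact .inr ⟨r, hrP, rfl, fun I J s _ _ hf =>
        ⟨s, (Rule.fires_closure_of_preds_subset hfresh (Program.rule_preds_subset hrP)).1 hf, rfl⟩⟩
    · exact .inr ⟨_, (hrule _).2 (.inr rfl), rfl, fun I J s hI hJ hf =>
        ⟨s, (hmain I J s hI hJ).2 hf, rfl⟩⟩

theorem program_safe {l₁ l₂ : List Rule} {W : List WeakConstraint} {H : List Atom}
    {b₁ b₂ : List Elt}
    (h : AggRewrite used (Rule.globals ⟨H, b₁ ++ e :: b₂⟩) (b₁ ++ e :: b₂) e e' R)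
    (hs : Program.Safe ⟨l₁ ++ ⟨H, b₁ ++ e :: b₂⟩ :: l₂, W⟩) :
    Program.Safe ⟨l₁ ++ ⟨H, b₁ ++ e' :: b₂⟩ :: R ++ l₂, W⟩ := by
  have hmain : Rule.Safe ⟨H, b₁ ++ e :: b₂⟩ := hs.1 _ (by simp)
  have hagg := bodyAggSafe_iff.1 hmain.2
  have he := h.aggSafe (hagg e (by simp))
  refine ⟨fun r hr => ?_, hs.2⟩
  simp only [List.mem_append, List.mem_cons] at hr
  rcases hr with (hr | rfl | hr) | hr
  · exact hs.1 r (by simp [hr])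
  · have hglob : (Rule.mk H (b₁ ++ e' :: b₂)).globals =
        (Rule.mk H (b₁ ++ e :: b₂)).globals := by
      rw [Rule.globals, Rule.globals, h.outerVars_replace]
    rw [Rule.Safe, hglob]
    refine ⟨fun x hx => h.bound_replace (hmain.1 x hx), bodyAggSafe_iff.2 fun c hc => ?_⟩
    simp only [List.mem_append, List.mem_cons] at hc
    rcases hc with hc | rfl | hc
    exacts [hagg c (by simp [hc]), he.1, hagg c (by simp [hc])]
  · exact he.2 r hr
  · exact hs.1 r (by simp [hr])

end AggRewrite

-- Feasibility of a split.

theorem exists_aggRules {used : Finset Pred} {φ ψ' : List Elt} {args : List Term}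
    (h : ∀ x ∈ termsVars args ∪ outerVars ψ', Bound φ ∅ x) :
    ∃ temp R, AggRules used φ ψ' args temp R := by
  obtain ⟨N, hN⟩ := exists_fresh used
  have hA : ∀ x, ∃ A, x ∈ (preAggRule N args ψ').unsafeVars → GreedySelection φ {x} A := by
    intro x
    by_cases hx : x ∈ (preAggRule N args ψ').unsafeVars
    · have hx' := (preAggRule N args ψ').unsafeVars_subset hx
      rw [preAggRule_globals] at hx'
      obtain ⟨A, hA⟩ := (h x hx').exists_greedySelection
      exact ⟨A, fun _ => hA⟩
    · exact ⟨[], fun h => absurd h hx⟩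
  choose A hA using hA
  -- All numbers from `N` on are fresh: `temp` is `N`, and the domain predicates start at `N + 1`.
  refine ⟨N, _, fun x => N + 1 + x, A, hN _ le_rfl, fun x _ y _ hxy => by simpa using hxy,
    fun x hx => ⟨hN _ ?_, ?_, hA x hx⟩, rfl⟩
  · exact (Nat.le_succ N).trans (Nat.le_add_right _ _)
  · exact ((Nat.lt_succ_self N).trans_le (Nat.le_add_right _ _)).ne

/-- If the domain predicates are defined by elements of the aggregate, then splitting an aggregate
that is not nested in another one introduces no recursion through aggregates. -/
theorem AggRules.nonrecursive {l₁ l₂ : List Rule} {W : List WeakConstraint} {H : List Atom}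
    {b₁ b₂ : List Elt} {t : Term} {cmp : Cmp} {f : AggFun} {tup args : List Term}
    {φ ψ ψ' : List Elt} {temp : Pred} {R : List Rule} {used : Finset Pred}
    (hu : Program.preds ⟨l₁ ++ ⟨H, b₁ ++ .agg t cmp f tup φ :: b₂⟩ :: l₂, W⟩ = used)
    (hP : Program.NonrecursiveAggregates ⟨l₁ ++ ⟨H, b₁ ++ .agg t cmp f tup φ :: b₂⟩ :: l₂, W⟩)
    (hφ : φ.Perm (ψ ++ ψ')) (hR : AggRules used φ ψ' args temp R) :
    Program.NonrecursiveAggregates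
      ⟨l₁ ++ ⟨H, b₁ ++ .agg t cmp f tup (ψ ++ [.pos ⟨temp, args⟩]) :: b₂⟩ :: R ++ l₂, W⟩ := by
  obtain ⟨level, hl⟩ := hP
  set P : Program := ⟨l₁ ++ ⟨H, b₁ ++ .agg t cmp f tup φ :: b₂⟩ :: l₂, W⟩
  -- Doubling makes room for a level `L` strictly between the predicates of `φ` and the heads of the
  -- rule. The offset `2` keeps heads above `L = 0` if `φ` has no predicates.
  set L : ℕ := (bodyPreds φ).sup fun p => 2 * level p + 3
  set level' : Pred → ℕ := fun p => if p ∈ used then 2 * level p + 2 else L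
  have hused : ∀ p ∈ used, level' p = 2 * level p + 2 := fun p hp => if_pos hp
  have hnew : ∀ p ∉ used, level' p = L := fun p hp => if_neg hp
  have hmono : ∀ r ∈ P.rules, r.Stratified level' := by
    intro r hr a ha
    have hB : ∀ p ∈ bodyPreds r.body, level' p = 2 * level p + 2 := fun p hp =>
      hused p (hu ▸ Program.rule_preds_subset hr (Finset.mem_union_right _ hp))
    rw [hused _ (hu ▸ Program.rule_preds_subset hr (Rule.head_preds ha))]
    refine ⟨fun b hb => ?_, fun p hp => ?_⟩
    · rw [hB _ (pos_pred_mem hb)]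
      have := (hl r hr a ha).1 b hb
      omega
    · rw [hB _ (aggPreds_subset _ hp)]
      have := (hl r hr a ha).2 p hp
      omega
  have hmain : (⟨H, b₁ ++ .agg t cmp f tup φ :: b₂⟩ : Rule) ∈ P.rules := by simp [P]
  have hφagg : ∀ p ∈ bodyPreds φ, p ∈ aggPreds (b₁ ++ .agg t cmp f tup φ :: b₂) := fun p hp =>
    ⟨t, cmp, f, tup, φ, by simp, hp⟩
  have hφused : ∀ p ∈ bodyPreds φ, p ∈ used := fun p hp => hu ▸
    Program.rule_preds_subset hmain (Finset.mem_union_right _ (aggPreds_subset _ (hφagg p hp)))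
  have hφL : ∀ p ∈ bodyPreds φ, level' p < L := fun p hp => by
    rw [hused p (hφused p hp)]
    exact Finset.le_sup (f := fun p => 2 * level p + 3) hp
  have hsub : ∀ e, e ∈ ψ ∨ e ∈ ψ' → ∀ p ∈ e.preds, p ∈ bodyPreds φ := fun e he p hp =>
    mem_bodyPreds.2 ⟨e, hφ.mem_iff.2 (List.mem_append.2 he), hp⟩
  have htemp : temp ∉ used := by
    obtain ⟨dom, A, ht, -⟩ := hR
    exact ht
  refine ⟨level', fun r hr => ?_⟩
  simp only [List.mem_append, List.mem_cons] at hr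
  rcases hr with (hr | rfl | hr) | hr
  · exact hmono r (by simp [P, hr])
  · intro a ha
    refine ⟨fun b hb => (hmono _ hmain a ha).1 b ?_, ?_⟩
    · simp only [List.mem_append, List.mem_cons, reduceCtorEq, false_or] at hb ⊢
      exact hb
    · have hold := (hmono _ hmain a ha).2
      rintro p ⟨t', cmp', f', tup', body, hm, hp⟩
      simp only [List.mem_append, List.mem_cons] at hm
      rcases hm with hm | hm | hm
      · exact hold p ⟨t', cmp', f', tup', body, by simp [hm], hp⟩
      · cases hm
        rw [bodyPreds_append, Finset.mem_union] at hp
        rcases hp with hp | hp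
        · obtain ⟨e, he, hp⟩ := mem_bodyPreds.1 hp
          exact hold p (hφagg p (hsub e (.inl he) p hp))
        · simp only [bodyPreds, Elt.preds, Finset.union_empty, Finset.mem_singleton] at hp
          subst hp
          rw [hnew _ htemp, hused _ (hu ▸ Program.rule_preds_subset hmain (Rule.head_preds ha)),
            Finset.sup_lt_iff (by simp)]
          intro p hp
          have := (hl _ hmain a ha).2 p (hφagg p hp)
          omega
      · exact hold p ⟨t', cmp', f', tup', body, by simp [hm], hp⟩
  · intro a ha
    rw [hnew _ (hR.head_fresh r hr a ha)]
    obtain ⟨dom, A, -, -, hd, rfl⟩ := hR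
    rcases List.mem_cons.1 hr with rfl | hr
    · refine ⟨fun b hb => ?_, ?_⟩
      · rcases List.mem_append.1 hb with hb | hb
        · exact (hφL _ (hsub _ (.inr hb) _ (by simp [Elt.preds]))).le
        · obtain ⟨x, hx, hb⟩ := mem_domAtoms.1 hb
          cases hb
          exact (hnew _ (hd x hx).1).le
      · rintro p ⟨t', cmp', f', tup', body, hm, hp⟩
        rcases List.mem_append.1 hm with hm | hm
        · exact hφL p (hsub _ (.inr hm) p (by simpa [Elt.preds] using hp))
        · obtain ⟨x, -, hm⟩ := mem_domAtoms.1 hm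
          cases hm
    · obtain ⟨x, hx, rfl⟩ := mem_domRules.1 hr
      have hg := (hd x hx).2.2
      refine ⟨fun b hb => (hφL _ (pos_pred_mem (hg.mem _ hb).1)).le, fun p hp => ?_⟩
      rw [hg.aggPreds_eq_empty] at hp
      exact hp.elim
  · exact hmono r (by simp [P, hr])

/-! ### Rooted trees -/

namespace RootedTree

variable (T : RootedTree)

/-- The distance from the root. -/
def depth (n : Fin T.size) : ℕ := Nat.find (T.reach n)

theorem iterate_depth (n : Fin T.size) : T.parent^[T.depth n] n = T.root :=
  Nat.find_spec (T.reach n)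

theorem depth_le {n : Fin T.size} {j : ℕ} (h : T.parent^[j] n = T.root) : T.depth n ≤ j :=
  Nat.find_min' _ h

theorem eq_root_of_depth_eq_zero {n : Fin T.size} (h : T.depth n = 0) : n = T.root := by
  have := T.iterate_depth n
  rwa [h] at this

theorem depth_root : T.depth T.root = 0 := Nat.le_zero.1 (T.depth_le rfl)

theorem depth_of_ne {n : Fin T.size} (h : n ≠ T.root) : T.depth n = T.depth (T.parent n) + 1 := by
  refine le_antisymm (T.depth_le ?_) ?_
  · rw [Function.iterate_succ_apply, iterate_depth]
  · obtain ⟨k, hk⟩ := Nat.exists_eq_succ_of_ne_zero fun h0 => h (T.eq_root_of_depth_eq_zero h0)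
    have := T.iterate_depth n
    rw [hk, Function.iterate_succ_apply] at this
    rw [hk]
    exact Nat.succ_le_succ (T.depth_le this)

theorem depth_parent (n : Fin T.size) : T.depth (T.parent n) = T.depth n - 1 := by
  by_cases h : n = T.root
  · rw [h, T.parent_root, T.depth_root]
  · rw [T.depth_of_ne h, Nat.add_sub_cancel]

/-- Truncated subtraction is exact because the root is its own parent. -/
theorem depth_iterate (n : Fin T.size) (j : ℕ) : T.depth (T.parent^[j] n) = T.depth n - j := by
  induction j with
  | zero => rfl
  | succ j ih => rw [Function.iterate_succ_apply', depth_parent, ih, Nat.sub_sub]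

theorem adj_iff {m n : Fin T.size} :
    T.graph.Adj m n ↔ m ≠ n ∧ (T.parent m = n ∨ T.parent n = m) := by
  rw [RootedTree.graph, SimpleGraph.fromRel_adj]

theorem reachable_root (n : Fin T.size) : T.graph.Reachable n T.root := by
  induction hk : T.depth n generalizing n with
  | zero => rw [T.eq_root_of_depth_eq_zero hk]
  | succ k ih =>
    have hn : n ≠ T.root := by
      rintro rfl
      rw [T.depth_root] at hk
      omega
    have hd := T.depth_of_ne hn
    have hadj : T.graph.Adj n (T.parent n) := by
      refine T.adj_iff.2 ⟨fun h => ?_, .inl rfl⟩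
      rw [← h] at hd
      omega
    exact hadj.reachable.trans (ih _ (by omega))

theorem mem_children {m n : Fin T.size} :
    m ∈ T.children n ↔ m ≠ T.root ∧ T.parent m = n := by
  simp [RootedTree.children]

/-- A walk that ends in `m` starts in a descendant of `m` or passes through the parent of `m`. -/
theorem exists_iterate_eq_or_parent_mem {u m : Fin T.size} (p : T.graph.Walk u m) :
    (∃ j : ℕ, T.parent^[j] u = m) ∨ T.parent m ∈ p.support := by
  induction p with
  | nil => exact .inl ⟨0, rfl⟩
  | cons hadj p ih =>
    rcases ih with ⟨j, hj⟩ | h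
    · rcases (T.adj_iff.1 hadj).2 with hk | hk
      · exact .inl ⟨j + 1, by rw [Function.iterate_succ_apply, hk, hj]⟩
      · cases j with
        | zero =>
          subst hk
          rw [Function.iterate_zero, id] at hj
          subst hj
          exact .inr (by simp)
        | succ j =>
          rw [Function.iterate_succ_apply, hk] at hj
          exact .inl ⟨j, hj⟩
    · exact .inr (by simp [h])

end RootedTree

/-! ### Tree decompositions -/

namespace TreeDecomposition

variable {V : Finset Var} {E : SimpleGraph Var} (d : TreeDecomposition V E)

theorem exists_walk {x : Var} {m n : Fin d.tree.size} (hm : x ∈ d.bag m) (hn : x ∈ d.bag n) :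
    ∃ p : d.tree.graph.Walk m n, ∀ k ∈ p.support, x ∈ d.bag k := by
  obtain ⟨p⟩ := (d.tree.reachable_root m).trans (d.tree.reachable_root n).symm
  exact ⟨p.toPath, fun k hk => d.path m n p.toPath p.toPath.2 k hk (Finset.mem_inter.2 ⟨hm, hn⟩)⟩

/-- A walk from `n` to `m` inside the bags with `x` can avoid the parent of `m` only if `n` is a
descendant of `m`, which the depths exclude. -/
theorem mem_bag_parent {x : Var} {m n : Fin d.tree.size} (hm : x ∈ d.bag m) (hn : x ∈ d.bag n)
    (hd : d.tree.depth n ≤ d.tree.depth m) (hne : n ≠ m) : x ∈ d.bag (d.tree.parent m) := by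
  obtain ⟨p, hp⟩ := d.exists_walk hn hm
  rcases d.tree.exists_iterate_eq_or_parent_mem p with ⟨j, hj⟩ | h
  · exfalso
    have h1 := d.tree.depth_iterate n j
    rw [hj] at h1
    rcases Nat.eq_zero_or_pos j with rfl | hj0
    · exact hne hj
    · have hn0 : d.tree.depth n = 0 := by omega
      have hm0 : d.tree.depth m = 0 := by omega
      exact hne ((d.tree.eq_root_of_depth_eq_zero hn0).trans
        (d.tree.eq_root_of_depth_eq_zero hm0).symm)
  · exact hp _ h

theorem mem_bag_iterate {x : Var} {m n : Fin d.tree.size} (hm : x ∈ d.bag m) (hn : x ∈ d.bag n)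
    {j : ℕ} (hd : d.tree.depth n + j ≤ d.tree.depth m) : x ∈ d.bag (d.tree.parent^[j] m) := by
  induction j with
  | zero => exact hm
  | succ j ih =>
    have hdj := d.tree.depth_iterate m j
    rw [Function.iterate_succ_apply']
    refine d.mem_bag_parent (ih (by omega)) hn (by omega) fun h => ?_
    rw [← h] at hdj
    omega

/-- Every clique is contained in a bag. -/
theorem exists_clique_subset_bag {C : Finset Var} (hV : C ⊆ V)
    (hC : ∀ x ∈ C, ∀ y ∈ C, x ≠ y → E.Adj x y) : ∃ n, C ⊆ d.bag n := by
  rcases C.eq_empty_or_nonempty with rfl | hne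
  · exact ⟨d.tree.root, Finset.empty_subset _⟩
  have htop : ∀ x, ∃ t, x ∈ C → x ∈ d.bag t ∧ ∀ n, x ∈ d.bag n → d.tree.depth t ≤ d.tree.depth n := by
    intro x
    by_cases hx : x ∈ C
    · obtain ⟨t, ht, hmin⟩ := Finset.exists_min_image (Finset.univ.filter fun n => x ∈ d.bag n)
        d.tree.depth (by simpa [Finset.Nonempty] using d.vertex x (hV hx))
      simp only [Finset.mem_filter, Finset.mem_univ, true_and] at ht hmin
      exact ⟨t, fun _ => ⟨ht, hmin⟩⟩
    · exact ⟨d.tree.root, fun h => absurd h hx⟩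
  choose t ht using htop
  -- The required bag is the deepest among the topmost bags `t x` of the variables of the clique
  -- (Helly property of subtrees).
  obtain ⟨x, hx, hmax⟩ := Finset.exists_max_image C (fun x => d.tree.depth (t x)) hne
  refine ⟨t x, fun y hy => ?_⟩
  obtain ⟨m, hxm, hym⟩ : ∃ m, x ∈ d.bag m ∧ y ∈ d.bag m := by
    by_cases hxy : x = y
    · exact ⟨t x, (ht x hx).1, hxy ▸ (ht x hx).1⟩
    · exact d.edge x y (hC x hx y hy hxy)
  have h1 := (ht x hx).2 m hxm
  have h2 := hmax y hy
  -- Climbing from a common bag of `x` and `y` to the depth of `t x` stays in bags of both, since `t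
  -- y` is no deeper than `t x`.
  set j := d.tree.depth m - d.tree.depth (t x) with hj
  have hxk := d.mem_bag_iterate hxm (ht x hx).1 (j := j) (by omega)
  have hyk := d.mem_bag_iterate hym (ht y hy).1 (j := j) (by omega)
  have hk := d.tree.depth_iterate m j
  have heq : d.tree.parent^[j] m = t x := by
    -- Another node with `x` at the depth of `t x` would put `x` into the parent of `t x`, against
    -- the choice of `t x`, unless both are the root.
    by_contra hne
    have h3 := (ht x hx).2 _ (d.mem_bag_parent (ht x hx).1 hxk (by omega) hne)
    rw [d.tree.depth_parent] at h3
    have h4 : d.tree.depth (t x) = 0 := by omega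
    have h5 : d.tree.depth (d.tree.parent^[j] m) = 0 := by omega
    exact hne ((d.tree.eq_root_of_depth_eq_zero h5).trans
      (d.tree.eq_root_of_depth_eq_zero h4).symm)
  exact heq ▸ hyk

theorem mem_bag_neighbor {x : Var} {m n : Fin d.tree.size} (hn : x ∈ d.bag n) (hm : x ∈ d.bag m)
    (hne : n ≠ m) : (n ≠ d.tree.root ∧ x ∈ d.bag (d.tree.parent n)) ∨
      ∃ k ∈ d.tree.children n, x ∈ d.bag k := by
  obtain ⟨p, hp⟩ := d.exists_walk hn hm
  cases p with
  | nil => exact absurd rfl hne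
  | @cons _ k _ hadj p =>
    have hk : x ∈ d.bag k := hp k (by simp)
    obtain ⟨hnk, h | h⟩ := d.tree.adj_iff.1 hadj
    · refine .inl ⟨fun hr => hnk ?_, h ▸ hk⟩
      rw [← h, hr, d.tree.parent_root]
    · refine .inr ⟨k, d.tree.mem_children.2 ⟨fun hr => hnk ?_, h⟩, hk⟩
      rw [← h, hr, d.tree.parent_root]

/-- Values for the variables in the bags that agree along the edges of the tree come from a single
assignment. -/
theorem exists_glue {α : Type*} (σ : Fin d.tree.size → Var → α)
    (h : ∀ n ≠ d.tree.root, ∀ x ∈ d.bag n ∩ d.bag (d.tree.parent n),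
      σ n x = σ (d.tree.parent n) x) :
    ∃ s : Var → α, ∀ n, ∀ x ∈ d.bag n, s x = σ n x := by
  have hedge : ∀ m n, d.tree.graph.Adj m n → ∀ x, x ∈ d.bag m → x ∈ d.bag n → σ m x = σ n x := by
    intro m n hadj x hm hn
    obtain ⟨hne, rfl | rfl⟩ := d.tree.adj_iff.1 hadj
    · exact h m (fun hr => hne (by rw [hr, d.tree.parent_root])) x (Finset.mem_inter.2 ⟨hm, hn⟩)
    · exact (h n (fun hr => hne (by rw [hr, d.tree.parent_root])) x
        (Finset.mem_inter.2 ⟨hn, hm⟩)).symm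
  -- The bags with `x` are connected, so agreement along edges makes the value at `x` independent of
  -- the bag.
  have hwalk : ∀ m n (p : d.tree.graph.Walk m n) x, (∀ k ∈ p.support, x ∈ d.bag k) →
      σ m x = σ n x := by
    intro m n p
    induction p with
    | nil => exact fun _ _ => rfl
    | cons hadj p ih =>
      intro x hx
      rw [hedge _ _ hadj x (hx _ (by simp)) (hx _ (by simp)),
        ih x fun k hk => hx k (by simp [hk])]
  classical
  refine ⟨fun x => if hx : ∃ n, x ∈ d.bag n then σ hx.choose x else σ d.tree.root x, ?_⟩
  intro n x hn
  have hx : ∃ n, x ∈ d.bag n := ⟨n, hn⟩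
  obtain ⟨p, hp⟩ := d.exists_walk hx.choose_spec hn
  simp only [dif_pos hx]
  exact hwalk _ _ p x hp

end TreeDecomposition

/-! ### Decomposition of a rule -/

namespace Rule

variable {r : Rule} (d : r.Decomposition) (temp : Fin d.tree.size → Pred)

theorem mem_bagElts {n : Fin d.tree.size} {e : Elt} :
    e ∈ r.bagElts d n ↔ e ∈ r.body ∧ e.vars ∩ r.globals ⊆ d.bag n := by
  simp [Rule.bagElts]

/-- The global variables of a body element are pairwise adjacent in the rule graph, and a clique
fits into a bag. -/
theorem exists_mem_bagElts {e : Elt} (he : e ∈ r.body) : ∃ n, e ∈ r.bagElts d n := by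
  obtain ⟨n, hn⟩ := d.exists_clique_subset_bag (C := e.vars ∩ r.globals)
    Finset.inter_subset_right fun x hx y hy hxy => by
      rw [Finset.mem_inter] at hx hy
      exact (SimpleGraph.fromRel_adj _ _ _).2
        ⟨hxy, .inl ⟨hx.2, hy.2, .inr ⟨e, he, hx.1, hy.1⟩⟩⟩
  exact ⟨n, (mem_bagElts d).2 ⟨he, hn⟩⟩

theorem mem_bag_iff {n : Fin d.tree.size} {e : Elt} (he : e ∈ r.bagElts d n) :
    ∀ x ∈ e.vars, x ∈ r.globals ↔ x ∈ d.bag n := fun _ hx =>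
  ⟨fun hg => ((mem_bagElts d).1 he).2 (Finset.mem_inter.2 ⟨hx, hg⟩), fun hb => d.bag_subset n hb⟩

theorem outerVars_subset_bag {n : Fin d.tree.size} {e : Elt} (he : e ∈ r.bagElts d n) :
    e.outerVars ⊆ d.bag n := fun x hx =>
  (mem_bag_iff d he x (e.outerVars_subset hx)).1
    (outerVars_subset_globals ((mem_bagElts d).1 he).1 hx)

theorem mem_tempAtom_vars {n : Fin d.tree.size} {x : Var} :
    x ∈ (r.tempAtom d temp n).vars ↔ x ∈ d.bag n ∩ d.bag (d.tree.parent n) := by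
  rw [Rule.tempAtom, Atom.vars, mem_varTerms_vars]

theorem mem_preNodeRule_body {n : Fin d.tree.size} {e : Elt} :
    e ∈ (r.preNodeRule d temp n).body ↔ e ∈ r.bagElts d n ∨
      ∃ m ∈ d.tree.children n, e = .pos (r.tempAtom d temp m) := by
  simp [Rule.preNodeRule, eq_comm]

/-- A bag variable occurs in the head of the rule or in an element placed in some bag. If that is
another node, a neighbour of `n` on the way also contains the variable, and it occurs in the
temporary atom of this edge. Equality is essential, since the global variables determine the meaning
of aggregates. -/
theorem preNodeRule_globals (n : Fin d.tree.size) :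
    (r.preNodeRule d temp n).globals = d.bag n := by
  ext x
  constructor
  · intro hx
    rcases Finset.mem_union.1 hx with hx | hx
    · simp only [Rule.preNodeRule] at hx
      split_ifs at hx with hn
      · exact hn ▸ d.head_subset hx
      · obtain ⟨a, ha, hx⟩ := mem_atomsVars.1 hx
        rw [List.mem_singleton] at ha
        subst ha
        exact (Finset.mem_inter.1 ((mem_tempAtom_vars d temp).1 hx)).1
    · obtain ⟨e, he, hx⟩ := mem_outerVars.1 hx
      rcases (mem_preNodeRule_body d temp).1 he with he | ⟨m, hm, rfl⟩
      · exact outerVars_subset_bag d he hx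
      · have := (Finset.mem_inter.1 ((mem_tempAtom_vars d temp).1 hx)).2
        rwa [(d.tree.mem_children.1 hm).2] at this
  · intro hx
    have hnb : ∀ m, x ∈ d.bag m → n ≠ m → x ∈ (r.preNodeRule d temp n).globals := by
      intro m hm hne
      rcases d.mem_bag_neighbor hx hm hne with ⟨hr, hp⟩ | ⟨k, hk, hxk⟩
      · refine Finset.mem_union_left _ ?_
        simp only [Rule.preNodeRule, if_neg hr]
        exact mem_atomsVars.2 ⟨_, List.mem_singleton_self _,
          (mem_tempAtom_vars d temp).2 (Finset.mem_inter.2 ⟨hx, hp⟩)⟩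
      · refine outerVars_subset_globals ((mem_preNodeRule_body d temp).2 (.inr ⟨k, hk, rfl⟩))
          ((mem_tempAtom_vars d temp).2 (Finset.mem_inter.2 ⟨hxk, ?_⟩))
        rwa [(d.tree.mem_children.1 hk).2]
    rcases Finset.mem_union.1 (d.bag_subset n hx) with hh | hb
    · by_cases hn : n = d.tree.root
      · refine Finset.mem_union_left _ ?_
        simp only [Rule.preNodeRule, if_pos hn]
        exact hh
      · exact hnb _ (d.head_subset hh) hn
    · obtain ⟨e, he, hxe⟩ := mem_outerVars.1 hb
      obtain ⟨m, hm⟩ := exists_mem_bagElts d he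
      by_cases hn : n = m
      · subst hn
        exact outerVars_subset_globals ((mem_preNodeRule_body d temp).2 (.inl hm)) hxe
      · exact hnb m (outerVars_subset_bag d hm hxe) hn

theorem domVars_subset (n : Fin d.tree.size) : r.domVars d temp n ⊆ d.bag n := by
  classical
  refine Finset.union_subset (fun x hx => ?_) ?_
  · obtain ⟨e, he, hx⟩ := mem_outerVars.1 (Finset.mem_filter.1 hx).1
    exact outerVars_subset_bag d he hx
  · exact (Rule.unsafeVars_subset _).trans (preNodeRule_globals d temp n).subset

theorem allDomVars_subset : r.allDomVars d temp ⊆ r.globals := by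
  intro x hx
  obtain ⟨n, -, hx⟩ := Finset.mem_biUnion.1 hx
  exact d.bag_subset n (domVars_subset d temp n hx)

theorem mem_allDomVars {n : Fin d.tree.size} {x : Var} (hx : x ∈ r.domVars d temp n) :
    x ∈ r.allDomVars d temp := Finset.mem_biUnion.2 ⟨n, Finset.mem_univ _, hx⟩

variable (dom : Var → Pred)

theorem mem_nodeRule_body {n : Fin d.tree.size} {e : Elt} :
    e ∈ (r.nodeRule d temp dom n).body ↔ e ∈ r.bagElts d n ∨
      (∃ m ∈ d.tree.children n, e = .pos (r.tempAtom d temp m)) ∨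
      ∃ x ∈ r.domVars d temp n, e = .pos ⟨dom x, [.var x]⟩ := by
  rw [Rule.nodeRule, List.mem_append, mem_preNodeRule_body, mem_domAtoms, or_assoc]

theorem nodeRule_globals (n : Fin d.tree.size) :
    (r.nodeRule d temp dom n).globals = d.bag n := by
  have h : (r.nodeRule d temp dom n).globals =
      (r.preNodeRule d temp n).globals ∪ r.domVars d temp n := by
    rw [Rule.globals, Rule.globals, Rule.nodeRule, outerVars_append, outerVars_domAtoms,
      Finset.union_assoc]
  rw [h, preNodeRule_globals, Finset.union_eq_left]
  exact domVars_subset d temp n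

theorem nodeRule_head_root : (r.nodeRule d temp dom d.tree.root).head = r.head := by
  simp [Rule.nodeRule, Rule.preNodeRule]

theorem nodeRule_head {n : Fin d.tree.size} (hn : n ≠ d.tree.root) :
    (r.nodeRule d temp dom n).head = [r.tempAtom d temp n] := by
  simp [Rule.nodeRule, Rule.preNodeRule, hn]

theorem nodeRule_safe (hr : r.Safe) (n : Fin d.tree.size) : (r.nodeRule d temp dom n).Safe := by
  refine ⟨fun x hx => ?_, bodyAggSafe_iff.2 fun e he => ?_⟩
  · by_cases hxd : x ∈ r.domVars d temp n
    · exact .pos ((mem_nodeRule_body d temp dom).2 (.inr (.inr ⟨x, hxd, rfl⟩)))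
        (by simp [Atom.vars, mem_termsVars, Term.vars])
    · rw [nodeRule_globals, ← preNodeRule_globals d temp] at hx
      simp only [Rule.domVars, Finset.mem_union, Rule.unsafeVars, Finset.mem_filter, not_or,
        not_and, not_not] at hxd
      exact (hxd.2 hx).mono (List.subset_append_left _ _) subset_rfl
  · rw [nodeRule_globals]
    rcases (mem_nodeRule_body d temp dom).1 he with he | ⟨m, -, rfl⟩ | ⟨x, -, rfl⟩
    · exact Elt.AggSafe.mono e (fun x hx => (mem_bag_iff d he x hx).1)
        (bodyAggSafe_iff.1 hr.2 e ((mem_bagElts d).1 he).1)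
    · trivial
    · trivial

/-- The rules that define the fresh predicates. -/
noncomputable def auxRules (A : Var → List Elt) : List Rule :=
  ((List.finRange d.tree.size).filter (· ≠ d.tree.root)).map (r.nodeRule d temp dom) ++
    domRules dom A (r.allDomVars d temp)

variable {d temp dom}

theorem mem_auxRules {A : Var → List Elt} {r' : Rule} : r' ∈ auxRules d temp dom A ↔
    (∃ n ≠ d.tree.root, r' = r.nodeRule d temp dom n) ∨
      ∃ x ∈ r.allDomVars d temp, r' = ⟨[⟨dom x, [.var x]⟩], A x⟩ := by
  simp only [auxRules, List.mem_append, mem_domRules, List.mem_map, List.mem_filter,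
    List.mem_finRange, true_and, decide_eq_true_eq, @eq_comm _ r']

theorem auxRules_head {used : Finset Pred} {A : Var → List Elt} (ht : ∀ n, temp n ∉ used)
    (hd : ∀ x ∈ r.globals, dom x ∉ used) :
    ∀ r' ∈ auxRules d temp dom A, ∃ h : Atom, r'.head = [h] ∧ h.pred ∉ used := by
  intro r' hr'
  rcases mem_auxRules.1 hr' with ⟨n, hn, rfl⟩ | ⟨x, hx, rfl⟩
  · exact ⟨_, nodeRule_head d temp dom hn, ht n⟩
  · exact ⟨_, rfl, hd x (allDomVars_subset d temp hx)⟩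

/-- One substitution serves all nodes: the temporary atoms are derived from the leaves upwards, and
the domain atoms from the body of the rule. -/
theorem fires_nodeRule {A : Var → List Elt}
    (hA : ∀ x ∈ r.allDomVars d temp, GreedySelection r.body {x} (A x)) {I J : Interp} {s : Subst}
    (hf : r.Fires I J s) (n : Fin d.tree.size) :
    (r.nodeRule d temp dom n).Fires I (closure (auxRules d temp dom A) I J) s := by
  -- Induction on the height above the maximal depth; at `k = 0` there are no such nodes.
  suffices h : ∀ k n, Finset.univ.sup d.tree.depth < d.tree.depth n + k →
      (r.nodeRule d temp dom n).Fires I (closure (auxRules d temp dom A) I J) s from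
    h (Finset.univ.sup d.tree.depth + 1) n (by omega)
  intro k
  induction k with
  | zero =>
    intro n hn
    have := Finset.le_sup (f := d.tree.depth) (Finset.mem_univ n)
    omega
  | succ k ih =>
    intro n hn e he
    rw [nodeRule_globals]
    rcases (mem_nodeRule_body d temp dom).1 he with he | ⟨m, hm, rfl⟩ | ⟨x, hx, rfl⟩
    · exact ((Elt.holdsRed_congr (.refl _ _) (.refl _ _) (mem_bag_iff d he) (fun _ _ => rfl)
        fun _ _ _ => rfl).1 (hf e ((mem_bagElts d).1 he).1)).mono subset_closure
    · obtain ⟨hmr, hmn⟩ := d.tree.mem_children.1 hm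
      have hdm := d.tree.depth_of_ne hmr
      rw [hmn] at hdm
      exact closure_step (mem_auxRules.2 (.inl ⟨m, hmr, rfl⟩)) (nodeRule_head d temp dom hmr)
        (ih m (by omega))
    · have hx' := mem_allDomVars d temp hx
      exact (hA x hx').mem_closure (mem_auxRules.2 (.inr ⟨x, hx', rfl⟩)) fun e he _ => hf e he

/-- As the fresh predicates are distinct, the temporary atom of `m` can only come from the rule of
`m`. -/
theorem exists_fires_child {used : Finset Pred} {A : Var → List Elt}
    (hinj : Function.Injective temp) (ht : ∀ n, temp n ∉ used)
    (hd : ∀ x ∈ r.globals, ∀ n, temp n ≠ dom x) {I J : Interp} (hJ : ∀ a ∈ J, a.1 ∈ used)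
    {m : Fin d.tree.size} {s : Subst} (hm : m ≠ d.tree.root)
    (hf : (r.nodeRule d temp dom (d.tree.parent m)).Fires I
      (closure (auxRules d temp dom A) I J) s) :
    ∃ s', (r.nodeRule d temp dom m).Fires I (closure (auxRules d temp dom A) I J) s' ∧
      ∀ x ∈ d.bag m ∩ d.bag (d.tree.parent m), s' x = s x := by
  have hmem := hf _ ((mem_nodeRule_body d temp dom).2
    (.inr (.inl ⟨m, d.tree.mem_children.2 ⟨hm, rfl⟩, rfl⟩)))
  rcases closure_inv hmem with h | ⟨r', hr', a, s', hh, heq, hf'⟩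
  · exact absurd (hJ _ h) (ht m)
  rcases mem_auxRules.1 hr' with ⟨n, hn, rfl⟩ | ⟨x, hx, rfl⟩
  · rw [nodeRule_head d temp dom hn, List.cons.injEq] at hh
    obtain ⟨rfl, -⟩ := hh
    obtain rfl : n = m := hinj (congrArg Prod.fst heq)
    exact ⟨s', hf', fun x hx => eq_of_map_subst_eq (congrArg Prod.snd heq)
      (mem_varTerms_vars.2 hx)⟩
  · simp only [List.cons.injEq, and_true] at hh
    subst hh
    exact absurd (congrArg Prod.fst heq).symm (hd x (allDomVars_subset d temp hx) m)

/-- Substitutions are chosen from the root downwards, each agreeing with that of the parent on the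
common variables, and then glued. Agreement on the root bag keeps the instance of the head. -/
theorem exists_fires_of_root {used : Finset Pred} {A : Var → List Elt}
    (hinj : Function.Injective temp) (ht : ∀ n, temp n ∉ used)
    (hd : ∀ x ∈ r.globals, dom x ∉ used ∧ ∀ n, temp n ≠ dom x) (hu : r.preds ⊆ used)
    {I J : Interp} (hJ : ∀ a ∈ J, a.1 ∈ used) {s : Subst}
    (hf : (r.nodeRule d temp dom d.tree.root).Fires I (closure (auxRules d temp dom A) I J) s) :
    ∃ s', r.Fires I J s' ∧ ∀ x ∈ d.bag d.tree.root, s' x = s x := by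
  have hnext : ∀ (m : Fin d.tree.size) (s : Subst), ∃ s' : Subst, m ≠ d.tree.root →
      (r.nodeRule d temp dom (d.tree.parent m)).Fires I (closure (auxRules d temp dom A) I J) s →
      (r.nodeRule d temp dom m).Fires I (closure (auxRules d temp dom A) I J) s' ∧
        ∀ x ∈ d.bag m ∩ d.bag (d.tree.parent m), s' x = s x := by
    intro m s
    by_cases h : m ≠ d.tree.root ∧ (r.nodeRule d temp dom (d.tree.parent m)).Fires I
        (closure (auxRules d temp dom A) I J) s
    · obtain ⟨s', hs'⟩ := exists_fires_child hinj ht (fun x hx => (hd x hx).2) hJ h.1 h.2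
      exact ⟨s', fun _ _ => hs'⟩
    · exact ⟨s, fun h1 h2 => absurd ⟨h1, h2⟩ h⟩
  choose next hnext using hnext
  -- Recursion along the path to the root, with the depth as fuel: `σ n` starts with `s` at the root
  -- and applies `next` at each node down to `n`.
  let g : ℕ → Fin d.tree.size → Subst := fun k =>
    k.rec (fun _ => s) fun _ g n => next n (g (d.tree.parent n))
  let σ : Fin d.tree.size → Subst := fun n => g (d.tree.depth n) n
  have hσ0 : σ d.tree.root = s := by
    simp only [σ, d.tree.depth_root]
    rfl
  have hσ : ∀ n ≠ d.tree.root, σ n = next n (σ (d.tree.parent n)) := by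
    intro n hn
    simp only [σ]
    rw [d.tree.depth_of_ne hn]
  have hfire : ∀ n, (r.nodeRule d temp dom n).Fires I
      (closure (auxRules d temp dom A) I J) (σ n) := by
    intro n
    induction hk : d.tree.depth n generalizing n with
    | zero =>
      rw [d.tree.eq_root_of_depth_eq_zero hk, hσ0]
      exact hf
    | succ k ih =>
      have hn : n ≠ d.tree.root := by
        rintro rfl
        rw [d.tree.depth_root] at hk
        omega
      rw [hσ n hn]
      exact (hnext n _ hn (ih _ (by rw [d.tree.depth_parent]; omega))).1
  obtain ⟨s', hs'⟩ := d.exists_glue σ fun n hn x hx => by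
    rw [hσ n hn]
    exact (hnext n _ hn (hfire _)).2 x hx
  refine ⟨s', fun e he => ?_, fun x hx => by rw [hs' _ x hx, hσ0]⟩
  obtain ⟨n, hn⟩ := exists_mem_bagElts d he
  have h := hfire n e ((mem_nodeRule_body d temp dom).2 (.inl hn))
  rw [nodeRule_globals] at h
  have hfresh : ∀ r' ∈ auxRules d temp dom A, ∀ h ∈ r'.head, h.pred ∉ used := by
    intro r' hr' a ha
    obtain ⟨b, hb, hb'⟩ := auxRules_head ht (fun x hx => (hd x hx).1) r' hr'
    rw [hb, List.mem_singleton] at ha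
    exact ha ▸ hb'
  have hep : e.preds ⊆ used := fun p hp =>
    hu (Finset.mem_union_right _ (mem_bodyPreds.2 ⟨e, he, hp⟩))
  exact (Elt.holdsRed_congr (.refl _ _) (fun a ha => (mem_closure_iff hfresh (hep ha)).symm)
    (mem_bag_iff d hn) (fun x hx => hs' n x (outerVars_subset_bag d hn hx))
    fun x hx hxg => hs' n x ((mem_bag_iff d hn x hx).1 hxg)).2 h

/-- There is a level for the fresh predicates between those of the body and those of the head. -/
theorem Stratified.exists_level {level : Pred → ℕ} (h : r.Stratified level) :
    ∃ L, (∀ a ∈ r.head, L ≤ level a.pred) ∧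
      (∀ a : Atom, Elt.pos a ∈ r.body → level a.pred ≤ L) ∧ ∀ p ∈ aggPreds r.body, level p < L := by
  rcases (atomsPreds r.head).eq_empty_or_nonempty with he | hne
  · refine ⟨(bodyPreds r.body).sup level + 1, fun a ha => ?_, fun a ha => ?_, fun p hp => ?_⟩
    · have := mem_atomsPreds.2 ⟨a, ha, rfl⟩
      rw [he] at this
      exact absurd this (Finset.notMem_empty _)
    · exact (Finset.le_sup (pos_pred_mem ha)).trans (Nat.le_succ _)
    · exact Nat.lt_succ_of_le (Finset.le_sup (aggPreds_subset _ hp))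
  · obtain ⟨p, hp, hmin⟩ := Finset.exists_min_image _ level hne
    obtain ⟨a, ha, rfl⟩ := mem_atomsPreds.1 hp
    exact ⟨level a.pred, fun b hb => hmin _ (mem_atomsPreds.2 ⟨b, hb, rfl⟩), (h a ha).1,
      (h a ha).2⟩

end Rule

-- The decomposition of a rule as a definitional extension.

section Step

variable {l₁ l₂ : List Rule} {W : List WeakConstraint} {r : Rule} {d : r.Decomposition}
  {temp : Fin d.tree.size → Pred} {dom : Var → Pred} {A : Var → List Elt}

open Rule

theorem mem_decomposed_iff {r' : Rule} :
    r' ∈ l₁ ++ ((List.finRange d.tree.size).map (r.nodeRule d temp dom) ++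
      domRules dom A (r.allDomVars d temp)) ++ l₂ ↔
    r' ∈ auxRules d temp dom A ∨ (r' ∈ l₁ ∨ r' ∈ l₂) ∨
      r' = r.nodeRule d temp dom d.tree.root := by
  rw [mem_auxRules]
  simp only [List.mem_append, List.mem_map, List.mem_finRange, true_and, mem_domRules]
  constructor
  · rintro ((h | ⟨n, rfl⟩ | h) | h)
    · exact .inr (.inl (.inl h))
    · by_cases hn : n = d.tree.root
      · exact .inr (.inr (by rw [hn]))
      · exact .inl (.inl ⟨n, hn, rfl⟩)
    · exact .inl (.inr h)
    · exact .inr (.inl (.inr h))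
  · rintro ((⟨n, -, rfl⟩ | h) | (h | h) | rfl)
    · exact .inl (.inr (.inl ⟨n, rfl⟩))
    · exact .inl (.inr (.inr h))
    · exact .inl (.inl h)
    · exact .inr h
    · exact .inl (.inr (.inl ⟨_, rfl⟩))

theorem decompose_definitionalExtension
    (hinj : Function.Injective temp) (ht : ∀ n, temp n ∉ Program.preds ⟨l₁ ++ r :: l₂, W⟩)
    (hd : ∀ x ∈ r.globals, dom x ∉ Program.preds ⟨l₁ ++ r :: l₂, W⟩ ∧ ∀ n, temp n ≠ dom x)
    (hA : ∀ x ∈ r.allDomVars d temp, GreedySelection r.body {x} (A x)) :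
    DefinitionalExtension ⟨l₁ ++ r :: l₂, W⟩
      ⟨l₁ ++ ((List.finRange d.tree.size).map (r.nodeRule d temp dom) ++
        domRules dom A (r.allDomVars d temp)) ++ l₂, W⟩ (auxRules d temp dom A) := by
  set P : Program := ⟨l₁ ++ r :: l₂, W⟩
  have hrule : ∀ r', r' ∈ P.rules ↔ (r' ∈ l₁ ∨ r' ∈ l₂) ∨ r' = r := by
    intro r'
    simp only [P, List.mem_append, List.mem_cons]
    tauto
  have hrP : r.preds ⊆ P.preds := Program.rule_preds_subset ((hrule r).2 (.inr rfl))
  have hhead := auxRules_head (A := A) ht fun x hx => (hd x hx).1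
  have hfresh : ∀ r' ∈ auxRules d temp dom A, ∀ h ∈ r'.head, h.pred ∉ P.preds := by
    intro r' hr' a ha
    obtain ⟨b, hb, hb'⟩ := hhead r' hr'
    rw [hb, List.mem_singleton] at ha
    exact ha ▸ hb'
  have hbody : ∀ e ∈ r.body, e.preds ⊆ P.preds := fun e he p hp =>
    hrP (Finset.mem_union_right _ (mem_bodyPreds.2 ⟨e, he, hp⟩))
  have htests : ∀ n, ∀ e ∈ (r.nodeRule d temp dom n).body, ¬ e.IsPos → e.preds ⊆ P.preds := by
    intro n e he hp
    rcases (mem_nodeRule_body d temp dom).1 he with he | ⟨m, -, rfl⟩ | ⟨x, -, rfl⟩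
    · exact hbody e ((mem_bagElts d).1 he).1
    · exact absurd trivial hp
    · exact absurd trivial hp
  -- The lemmas on node rules test in `I`, a definitional extension in the closure; the tests of the
  -- root rule use old predicates only, so this is the same.
  have hroot : ∀ I J s, (r.nodeRule d temp dom d.tree.root).Fires I J s ↔
      (r.nodeRule d temp dom d.tree.root).Fires (closure (auxRules d temp dom A) I I) J s := by
    intro I J s
    simp only [Rule.fires_iff]
    refine and_congr_left fun _ => forall₃_congr fun e he hp => ?_
    exact Elt.holds_congr e (fun a ha => (mem_closure_iff hfresh (htests _ e he hp ha)).symm)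
      (fun _ _ => Iff.rfl) (fun _ _ => rfl) fun _ _ _ => rfl
  refine ⟨fun p hp => ?_, fun r' hr' => mem_decomposed_iff.2 (.inl hr'), hhead,
    fun r' hr' e he hp => ?_, fun r' hr' => ?_, fun r' hr' => ?_⟩
  · rw [Program.mem_preds] at hp ⊢
    rcases hp with ⟨r', hr', hp⟩ | hp
    · rcases (hrule r').1 hr' with hr' | rfl
      · exact .inl ⟨r', mem_decomposed_iff.2 (.inr (.inl hr')), hp⟩
      · have hnode : ∀ n, r'.nodeRule d temp dom n ∈
            l₁ ++ ((List.finRange d.tree.size).map (r'.nodeRule d temp dom) ++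
              domRules dom A (r'.allDomVars d temp)) ++ l₂ := fun n => by simp
        rcases Finset.mem_union.1 hp with hp | hp
        · refine .inl ⟨_, hnode d.tree.root, Finset.mem_union_left _ ?_⟩
          rwa [nodeRule_head_root]
        · obtain ⟨e, he, hp⟩ := mem_bodyPreds.1 hp
          obtain ⟨n, hn⟩ := exists_mem_bagElts d he
          exact .inl ⟨_, hnode n, Finset.mem_union_right _
            (mem_bodyPreds.2 ⟨e, (mem_nodeRule_body d temp dom).2 (.inl hn), hp⟩)⟩
    · exact .inr hp
  · rcases mem_auxRules.1 hr' with ⟨n, -, rfl⟩ | ⟨x, hx, rfl⟩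
    · exact htests n e he hp
    · rw [((hA x hx).mem e he).2.preds_eq_empty hp]
      exact Finset.empty_subset _
  · rcases (hrule r').1 hr' with hl | rfl
    · exact ⟨r', mem_decomposed_iff.2 (.inr (.inl hl)), fun I J s _ _ hf =>
        ⟨s, (Rule.fires_closure_of_preds_subset hfresh (Program.rule_preds_subset hr')).2 hf, rfl⟩⟩
    · refine ⟨_, mem_decomposed_iff.2 (.inr (.inr rfl)), fun I J s _ _ hf => ⟨s, ?_, ?_⟩⟩
      · exact (hroot I _ s).1 (fires_nodeRule hA hf _)
      · rw [nodeRule_head_root]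
  · rcases mem_decomposed_iff.1 hr' with hr' | hl | rfl
    · exact .inl hr'
    · have hl' := (hrule r').2 (.inl hl)
      exact .inr ⟨r', hl', rfl, fun I J s _ _ hf =>
        ⟨s, (Rule.fires_closure_of_preds_subset hfresh (Program.rule_preds_subset hl')).1 hf, rfl⟩⟩
    · refine .inr ⟨r, (hrule r).2 (.inr rfl), nodeRule_head_root d temp dom,
        fun I J s hI hJ hf => ?_⟩
      obtain ⟨s', hf', hs'⟩ := exists_fires_of_root hinj ht hd hrP (fun a ha => hI a (hJ ha))
        ((hroot I _ s).2 hf)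
      refine ⟨s', hf', ?_⟩
      rw [nodeRule_head_root]
      exact List.map_congr_left fun a ha => Atom.subst_congr fun x hx =>
        hs' x (d.head_subset (mem_atomsVars.2 ⟨a, ha, hx⟩))

theorem decompose_nonrecursive
    (ht : ∀ n, temp n ∉ Program.preds ⟨l₁ ++ r :: l₂, W⟩)
    (hd : ∀ x ∈ r.globals, dom x ∉ Program.preds ⟨l₁ ++ r :: l₂, W⟩)
    (hA : ∀ x ∈ r.allDomVars d temp, GreedySelection r.body {x} (A x))
    (hP : Program.NonrecursiveAggregates ⟨l₁ ++ r :: l₂, W⟩) :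
    Program.NonrecursiveAggregates
      ⟨l₁ ++ ((List.finRange d.tree.size).map (r.nodeRule d temp dom) ++
        domRules dom A (r.allDomVars d temp)) ++ l₂, W⟩ := by
  obtain ⟨level, hl⟩ := hP
  set P : Program := ⟨l₁ ++ r :: l₂, W⟩
  have hr : r ∈ P.rules := by simp [P]
  have hrP : r.preds ⊆ P.preds := Program.rule_preds_subset hr
  obtain ⟨L, h1, h2, h3⟩ := Rule.Stratified.exists_level (hl r hr)
  -- All fresh predicates share one level between body and head, which is enough because positive
  -- dependencies need not be strict and the aggregates are strictly below it.
  set level' : Pred → ℕ := fun p => if p ∈ P.preds then level p else L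
  have hused : ∀ p ∈ P.preds, level' p = level p := fun p hp => if_pos hp
  have hnew : ∀ p ∉ P.preds, level' p = L := fun p hp => if_neg hp
  have hpos : ∀ a : Atom, Elt.pos a ∈ r.body → level' a.pred ≤ L := fun a ha => by
    rw [hused _ (hrP (Finset.mem_union_right _ (pos_pred_mem ha)))]
    exact h2 a ha
  have hagg : ∀ p ∈ aggPreds r.body, level' p < L := fun p hp => by
    rw [hused _ (hrP (Finset.mem_union_right _ (aggPreds_subset _ hp)))]
    exact h3 p hp
  have hnode : ∀ n, (∀ a : Atom, Elt.pos a ∈ (r.nodeRule d temp dom n).body → level' a.pred ≤ L) ∧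
      ∀ p ∈ aggPreds (r.nodeRule d temp dom n).body, level' p < L := by
    intro n
    refine ⟨fun a ha => ?_, ?_⟩
    · rcases (mem_nodeRule_body d temp dom).1 ha with ha | ⟨m, -, ha⟩ | ⟨x, hx, ha⟩
      · exact hpos a ((mem_bagElts d).1 ha).1
      · cases ha
        exact (hnew _ (ht m)).le
      · cases ha
        exact (hnew _ (hd x (allDomVars_subset d temp (mem_allDomVars d temp hx)))).le
    · rintro p ⟨t, cmp, f, tup, body, hm, hp⟩
      rcases (mem_nodeRule_body d temp dom).1 hm with hm | ⟨m, -, hm⟩ | ⟨x, hx, hm⟩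
      · exact hagg p ⟨t, cmp, f, tup, body, ((mem_bagElts d).1 hm).1, hp⟩
      · cases hm
      · cases hm
  refine ⟨level', fun r' hr' => ?_⟩
  rcases mem_decomposed_iff.1 hr' with hr' | hr' | rfl
  · intro a ha
    rcases mem_auxRules.1 hr' with ⟨n, hn, rfl⟩ | ⟨x, hx, rfl⟩
    · rw [nodeRule_head d temp dom hn, List.mem_singleton] at ha
      subst ha
      rw [hnew (r.tempAtom d temp n).pred (ht n)]
      exact hnode n
    · rw [List.mem_singleton] at ha
      subst ha
      rw [hnew (dom x) (hd x (allDomVars_subset d temp hx))]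
      refine ⟨fun b hb => hpos b ((hA x hx).mem _ hb).1, fun p hp => ?_⟩
      rw [(hA x hx).aggPreds_eq_empty] at hp
      exact hp.elim
  · have hr'P : r' ∈ P.rules := by
      simp only [P, List.mem_append, List.mem_cons]
      tauto
    exact Rule.Stratified.congr (hl r' hr'P) fun p hp =>
      hused p (Program.rule_preds_subset hr'P hp)
  · intro a ha
    rw [nodeRule_head_root] at ha
    rw [hused _ (hrP (Rule.head_preds ha))]
    exact ⟨fun b hb => ((hnode _).1 b hb).trans (h1 a ha), fun p hp =>
      ((hnode _).2 p hp).trans_le (h1 a ha)⟩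

theorem decompose_safe
    (hA : ∀ x ∈ r.allDomVars d temp, GreedySelection r.body {x} (A x))
    (hP : Program.Safe ⟨l₁ ++ r :: l₂, W⟩) :
    Program.Safe ⟨l₁ ++ ((List.finRange d.tree.size).map (r.nodeRule d temp dom) ++
        domRules dom A (r.allDomVars d temp)) ++ l₂, W⟩ := by
  have hr : r.Safe := hP.1 r (by simp)
  refine ⟨fun r' hr' => ?_, hP.2⟩
  rcases mem_decomposed_iff.1 hr' with hr' | hr' | rfl
  · rcases mem_auxRules.1 hr' with ⟨n, -, rfl⟩ | ⟨x, hx, rfl⟩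
    · exact nodeRule_safe d temp dom hr n
    · exact (hA x hx).domRule_safe _
  · refine hP.1 r' ?_
    simp only [List.mem_append, List.mem_cons]
    tauto
  · exact nodeRule_safe d temp dom hr _

end Step

-- Feasibility of a decomposition, and composition of steps.

theorem Rule.Safe.exists_decomposesTo {r : Rule} (h : r.Safe) (used : Finset Pred)
    (d : r.Decomposition) : ∃ R, r.DecomposesTo used d R := by
  obtain ⟨N, hN⟩ := exists_fresh used
  let temp : Fin d.tree.size → Pred := fun n => N + n
  have hA : ∀ x, ∃ A, x ∈ r.allDomVars d temp → GreedySelection r.body {x} A := by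
    intro x
    by_cases hx : x ∈ r.allDomVars d temp
    · obtain ⟨A, hA⟩ := (h.1 x (Rule.allDomVars_subset d temp hx)).exists_greedySelection
      exact ⟨A, fun _ => hA⟩
    · exact ⟨[], fun h => absurd h hx⟩
  choose A hA using hA
  refine ⟨_, temp, fun x => N + d.tree.size + x, A, fun m n hmn => Fin.ext (Nat.add_left_cancel hmn),
    fun n => hN _ (Nat.le_add_right _ _), fun x _ y _ hxy => Nat.add_left_cancel hxy,
    fun x _ => ⟨hN _ ?_, fun n => ?_⟩, hA, rfl⟩
  · dsimp only
    rw [Nat.add_assoc]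
    exact Nat.le_add_right _ _
  · dsimp only
    rw [Nat.add_assoc]
    exact fun hn => absurd (Nat.add_left_cancel hn)
      (n.isLt.trans_le (Nat.le_add_right _ _)).ne

theorem Step.refines {P Q : Program} (h : Step P Q) (hs : P.Safe)
    (hP : P.NonrecursiveAggregates) : Q.Refines P := by
  cases h with
  | rule h =>
    obtain ⟨temp, dom, A, hinj, ht, -, hd, hA, rfl⟩ := h
    exact (decompose_definitionalExtension hinj ht hd hA).refines hP
      (decompose_nonrecursive ht (fun x hx => (hd x hx).1) hA hP) (decompose_safe hA hs) rfl
  | weak h => exact weak_refines h hs hP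
  | aggregate h hQ => exact h.definitionalExtension.refines hP hQ (h.program_safe hs) rfl

theorem Rewrites.refines {P Q : Program} (h : Rewrites P Q) (hs : P.Safe)
    (hP : P.NonrecursiveAggregates) : Q.Refines P := by
  induction h with
  | refl => exact .refl hs hP
  | tail _ hstep ih => exact (hstep.refines ih.safe ih.nonrecursive).trans ih

end Asp

theorem mainTheorem1 (P : Asp.Program) (hsafe : P.Safe) (hagg : P.NonrecursiveAggregates) :
    (∀ Q : Asp.Program, Asp.Rewrites P Q →
      Q.Safe ∧ Q.NonrecursiveAggregates ∧
      Set.BijOn (Asp.restrict P.preds) {I | Q.AnswerSet I} {I | P.AnswerSet I} ∧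
      (∀ I, Q.AnswerSet I → Q.weight I = P.weight (Asp.restrict P.preds I)) ∧
      Set.BijOn (Asp.restrict P.preds) {I | Q.OptimalAnswerSet I} {I | P.OptimalAnswerSet I}) ∧
    (∀ r ∈ P.rules, ∀ d : r.Decomposition, ∃ R, r.DecomposesTo P.preds d R) ∧
    (∀ (l₁ l₂ : List Asp.Rule) (H : List Asp.Atom) (b₁ b₂ : List Asp.Elt) (t : Asp.Term)
      (cmp : Asp.Cmp) (f : Asp.AggFun) (tup : List Asp.Term) (φ ψ ψ' : List Asp.Elt)
      (args : List Asp.Term),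
      P.rules = l₁ ++ ⟨H, b₁ ++ .agg t cmp f tup φ :: b₂⟩ :: l₂ →
      Asp.AggPartition (Asp.Rule.globals ⟨H, b₁ ++ .agg t cmp f tup φ :: b₂⟩) tup φ ψ ψ' args →
      (∀ x ∈ Asp.termsVars args ∪ Asp.outerVars ψ', Asp.Bound φ ∅ x) →
      ∃ (temp : Asp.Pred) (R : List Asp.Rule),
        Asp.Step P ⟨l₁ ++ ⟨H, b₁ ++ .agg t cmp f tup (ψ ++ [.pos ⟨temp, args⟩]) :: b₂⟩ :: R ++ l₂,
          P.weak⟩)  := by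
  refine ⟨fun Q hQ => ?_, fun r hr d => (hsafe.1 r hr).exists_decomposesTo _ d, ?_⟩
  · have h := hQ.refines hsafe hagg
    exact ⟨h.safe, h.nonrecursive, h.bijOn, h.weight, h.bijOn_optimal⟩
  · rintro l₁ l₂ H b₁ b₂ t cmp f tup φ ψ ψ' args hP hpart hb
    obtain ⟨rules, W⟩ := P
    obtain rfl : rules = l₁ ++ ⟨H, b₁ ++ .agg t cmp f tup φ :: b₂⟩ :: l₂ := hP
    -- Selecting from `φ` alone keeps the fresh predicates below the heads of the rule, so no
    -- recursion through aggregates arises.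
    obtain ⟨temp, R, hR⟩ := Asp.exists_aggRules
      (used := Asp.Program.preds ⟨l₁ ++ ⟨H, b₁ ++ .agg t cmp f tup φ :: b₂⟩ :: l₂, W⟩) hb
    exact ⟨temp, R, .aggregate (.here hpart (List.subset_append_right _ _) hR)
      (hR.nonrecursive rfl hagg hpart.perm)⟩
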